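/- **Game.** There are $K$ arms and $M$ players, $1<M\le K$. An oblivious adversary fixes losses $l_k(t)\in[0,1]$ in advance. In slot $t$ player $m$ pulls an arm $\pi_m(t)$ and receives (and observes) only the loss $s_m(t)=l_{\pi_m(t)}(t)$ if no other player pulls the same arm, and $s_m(t)=1$ if there is a collision; collisions are not observed and there is no other communication. The regret over the horizon $T$ is $$R(T)=\sum_{t=1}^T\sum_{m=1}^M s_m(t)-\min_{k_1,\dots,k_M\ \text{distinct}}\ \sum_{t=1}^T\sum_{m=1}^M l_{k_m}(t),$$ and the global attackability is $V(T)=\max_k|\{t\le T: l_k(t)=1\}|$. **Algorithm ($\beta$-aware A2C2).** Let $\beta\in[0,1]$ be known and put $\nu=\max\{\frac{3\beta-1}2,0\}$, $\tau=\lceil K^{1/3}\log(K)^{-1/3}T^{\max\{\beta,1/3\}}\rceil$, $\eta=\sqrt{\log\binom KM\,\tau/(MKT)}$; let $r\ge 1$ be the repetition length of the code. Player $1$ is the leader, the others are followers, and player $m$ has communication arm $m$. In each round $p=1,2,\dots$ (until the horizon $T$ is reached): 1. The leader draws a set $A$ of $M$ arms with probability $P_A(p)\propto\exp\big(-\eta\sum_{v<p}\sum_{k\in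 A}\tilde l_k(v)\big)$ and permutes it uniformly at random into $(\tilde A_1,\dots,\tilde A_M)$. 2. For each follower $m=2,\dots,M$ in turn, the leader sends $K$ blocks of $r$ slots: during block $\tilde A_m$ she pulls arm $m$, during the other blocks she pulls arm $1$, while every follower stays on her own communication arm. Follower $m$ decodes the set $S_m$ of those blocks in which she received loss $1$ in all $r$ slots, and raises an error flag if $|S_m|>1$. 3. During $r$ further slots the flagged followers pull arm $1$ and all other players their own communication arms. The leader sets $F=1$ if she received loss $1$ in all these $r$ slots, and $F=0$ otherwise. 4. For $\tau$ slots the leader pulls $\tilde A_1$, and each follower $m$ pulls an arm that she has chosen independently and uniformly from $S_m$. If $F=0$, the leader sets $\tilde l_k(p)=\frac M\tau\,\frac{\hat l\,\mathbf 1\{\tilde A_1=k\}}{\sum_{A\ni k}P_A(p)}$ for each arm $k$, where $\hat l$ is the total loss she received during these $\tau$ slots; if $F=1$, she sets $\tilde l_k(p)=0$ for all $k$. **Theorem (β-aware).** (a) For all constants $v,c_1,c_2>0$ there is a constant $C>0$, depending only on $v,c_1,c_2$, such that for all $1<M\le K$, $\beta\in[0,1]$, $T\ge1$, all code lengths $r$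 with $c_1T^\nu\le r\le c_2T^\nu$ (that is, $r=\Theta(T^\nu)$), and all loss sequences with $V(T)\le vT^\beta$ (that is, $V(T)=O(T^\beta)$), the expected regret of the algorithm, over its own randomization, satisfies $$\mathbb E[R(T)]\le C\,M^2K^{2/3}\log(K)^{1/3}\,T^{\max\{\frac{1+\beta}2,\frac23\}},$$ and in every realization the number of failed communication phases completed within the horizon (those in which some follower raises an error flag or the leader sets $F=1$) is at most $C\,M\,T^{\beta-\nu}$. (b) No coding is needed when $\beta\le\frac13$: for every $v>0$ there is $C>0$, depending only on $v$, such that with $r=1$ (every bit is sent once), for all $1<M\le K$, $\beta\in[0,\frac13]$, $T\ge1$ and all loss sequences with $V(T)\le vT^\beta$, $$\mathbb E[R(T)]\le C\,M^2K^{2/3}\log(K)^{1/3}\,T^{2/3}.$$ -/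

import Mathlib

namespace A2C2

open Classical Finset

noncomputable section

/-! ### The no-sensing adversarial multi-player bandit game -/

/-- The collision indicator `η_k = 1{|{n | π_n = k}| > 1}` of arm `k` when player `n` pulls `π n`. -/
def collision {M K : ℕ} (π : Fin M → Fin K) (k : Fin K) : ℝ :=
  if 1 < #{n | π n = k} then 1 else 0

/-- The loss `s = l (1 - η) + η` that player `m` receives in one slot with true losses `loss`. -/
def received {M K : ℕ} (loss : Fin K → ℝ) (π : Fin M → Fin K) (m : Fin M) : ℝ :=
  loss (π m) * (1 - collision π (π m)) + collision π (π m)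

/-- The regret over `T` slots of the pulls `π` against the loss sequence `l` (slot `t` has the
losses `l t`), relative to the best fixed collision-free allocation of players to arms.  For
`M ≤ K` the infimum is a minimum over a finite nonempty set. -/
def regret {M K : ℕ} (l : ℕ → Fin K → ℝ) (T : ℕ) (π : Fin T → Fin M → Fin K) : ℝ :=
  (∑ t : Fin T, ∑ m, received (l t) (π t) m)
    - ⨅ a : Fin M ↪ Fin K, ∑ t : Fin T, ∑ m, l t (a m)

/-- The global attackability: the maximum over the arms of the number of losses equal to `1`
during the first `T` slots. -/
def globalAttackability {K : ℕ} (l : ℕ → Fin K → ℝ) (T : ℕ) : ℕ :=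
  Finset.univ.sup fun k : Fin K => #{t ∈ Finset.range T | l t k = 1}

/-! ### Codes: a received loss `1` is read as bit `1`, any other loss as bit `0` -/

/-- Bit `j` of the error-detection codeword of arm `k`, before repetition. -/
def eEncoder {K : ℕ} (k : Fin K) (j : Fin K) : Prop := j = k

/-- The error-detection decoder: the indices of the blocks that are received as all ones, where
`s j i` is the loss received in repetition `i` of block `j`. -/
def eDecoder {K r : ℕ} (s : Fin K → Fin r → ℝ) : Finset (Fin K) := {j | ∀ i, s j i = 1}

/-- The repetition decoder outputs bit `1` iff all ones are received. -/
def rDecoder {r : ℕ} (s : Fin r → ℝ) : Prop := ∀ i, s i = 1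

/-! ### The algorithm -/

/-- Parameters: `M` players, `K` arms, `rep` repetitions of every transmitted bit, exploration
phases of `τ` slots, and the learning rate `η` of the leader. -/
structure Params where
  M : ℕ
  K : ℕ
  one_lt_M : 1 < M
  M_le_K : M ≤ K
  rep : ℕ
  τ : ℕ
  η : ℝ

namespace Params

variable (c : Params)

/-- Player `0` is the leader, all the others are followers. -/
def leader : Fin c.M := ⟨0, lt_trans Nat.zero_lt_one c.one_lt_M⟩

/-- The communication arm of player `m` is the arm with the same index. -/
def commArm (m : Fin c.M) : Fin c.K := Fin.castLE c.M_le_K m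

/-- Number of slots in which the leader sends the assignments: for each of the `M - 1` followers
`K` blocks of `rep` slots. -/
def assignLen : ℕ := (c.M - 1) * c.K * c.rep

/-- Number of slots of a communication phase: the assignments, then `rep` slots of error report. -/
def commLen : ℕ := c.assignLen + c.rep

/-- Number of slots of a communication phase followed by an exploration phase. -/
def phaseLen : ℕ := c.commLen + c.τ

/-- The slot, inside a phase, of repetition `i` of block `j` of the message for the follower `m`. -/
def assignSlot (m : Fin c.M) (j : Fin c.K) (i : Fin c.rep) : ℕ :=
  (((m : ℕ) - 1) * c.K + j) * c.rep + i

/-- A subset of `M` distinct arms. -/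
abbrev MetaArm : Type := {A : Finset (Fin c.K) // #A = c.M}

/-- An assignment of distinct arms to the players (a permuted meta-arm). -/
abbrev Assignment : Type := Fin c.M ↪ Fin c.K

/-- The random choices made in one phase: the assignment drawn by the leader, and the arms that
the players explore. -/
abbrev Outcome : Type := c.Assignment × (Fin c.M → Fin c.K)

theorem K_pos : 0 < c.K := lt_of_lt_of_le (lt_trans Nat.zero_lt_one c.one_lt_M) c.M_le_K

/-- The follower who is in turn to receive in slot `o` of a phase. -/
def receiver (o : ℕ) : ℕ := o / c.rep / c.K + 1

/-- The block of the message to which slot `o` of a phase belongs. -/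
def block (o : ℕ) : Fin c.K := ⟨o / c.rep % c.K, Nat.mod_lt _ c.K_pos⟩

/-- The pulls in slot `o < assignLen` of a phase, while the leader sends the assignment `a`.  A
follower stays on her communication arm.  The leader pulls the communication arm of the follower
in turn to send bit `1`, and stays on her own communication arm to send bit `0`. -/
def assignPull (a : c.Assignment) (o : ℕ) (m : Fin c.M) : Fin c.K :=
  if m = c.leader then
    if h : c.receiver o < c.M then
      if eEncoder (a ⟨c.receiver o, h⟩) (c.block o) then c.commArm ⟨c.receiver o, h⟩
      else c.commArm c.leader
    else c.commArm c.leader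
  else c.commArm m

/-! The remaining definitions depend on the loss sequence `l`; phases are numbered `p = 0, 1, …`
and phase `p` starts in slot `p * phaseLen`. -/

variable (l : ℕ → Fin c.K → ℝ)

/-- What the follower `m` decodes in phase `p` from the losses received on her communication
arm. -/
def decoded (p : ℕ) (a : c.Assignment) (m : Fin c.M) : Finset (Fin c.K) :=
  eDecoder fun j (i : Fin c.rep) =>
    received (l (p * c.phaseLen + c.assignSlot m j i)) (c.assignPull a (c.assignSlot m j i)) m

/-- The error flag of the follower `m` in phase `p`. -/
def followerFlag (p : ℕ) (a : c.Assignment) (m : Fin c.M) : Prop := 1 < #(c.decoded l p a m)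

/-- The pulls during the error report of phase `p`: all flagged followers send bit `1` by pulling
the leader's communication arm; everybody else is on her own communication arm. -/
def reportPull (p : ℕ) (a : c.Assignment) (m : Fin c.M) : Fin c.K :=
  if m ≠ c.leader ∧ c.followerFlag l p a m then c.commArm c.leader else c.commArm m

/-- The flag `F` decoded by the leader in phase `p`. -/
def leaderFlag (p : ℕ) (a : c.Assignment) : Prop :=
  rDecoder fun i : Fin c.rep =>
    received (l (p * c.phaseLen + (c.assignLen + i))) (c.reportPull l p a) c.leader

/-- The set in which player `m` picks her arm for the exploration phase, uniformly at random: the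
leader takes the arm assigned to her, a follower picks in the set she has decoded. -/
def exploreSet (p : ℕ) (a : c.Assignment) (m : Fin c.M) : Finset (Fin c.K) :=
  if m = c.leader then {a c.leader} else c.decoded l p a m

/-- Bit `1` is always received correctly. -/
theorem mem_exploreSet (p : ℕ) (a : c.Assignment) (m : Fin c.M) : a m ∈ c.exploreSet l p a m := by
  unfold exploreSet
  split_ifs with hm
  · simp [hm]
  have hm0 : 0 < (m : ℕ) := by
    rcases Nat.eq_zero_or_pos (m : ℕ) with h | h
    · exact absurd (Fin.ext h) hm
    · exact h
  simp only [decoded, eDecoder, Finset.mem_filter, Finset.mem_univ, true_and]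
  intro i
  have hrep : 0 < c.rep := lt_of_le_of_lt (Nat.zero_le _) i.2
  have hb : c.assignSlot m (a m) i / c.rep = ((m : ℕ) - 1) * c.K + (a m : ℕ) := by
    unfold assignSlot
    rw [mul_comm, Nat.mul_add_div hrep, Nat.div_eq_of_lt i.2, add_zero]
  have hq : c.receiver (c.assignSlot m (a m) i) = (m : ℕ) := by
    rw [receiver, hb, mul_comm, Nat.mul_add_div c.K_pos, Nat.div_eq_of_lt (a m).2]
    omega
  have hj : c.block (c.assignSlot m (a m) i) = a m := by
    apply Fin.ext
    simp only [block]
    rw [hb, mul_comm, Nat.mul_add_mod, Nat.mod_eq_of_lt (a m).2]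
  have hlt : c.receiver (c.assignSlot m (a m) i) < c.M := by rw [hq]; exact m.2
  have hm' : (⟨c.receiver (c.assignSlot m (a m) i), hlt⟩ : Fin c.M) = m := Fin.ext hq
  have h1 : c.assignPull a (c.assignSlot m (a m) i) c.leader = c.commArm m := by
    unfold assignPull
    rw [if_pos rfl, dif_pos hlt, hm', hj]
    exact if_pos rfl
  have h2 : c.assignPull a (c.assignSlot m (a m) i) m = c.commArm m := by
    unfold assignPull
    rw [if_neg hm]
  have hcol : 1 < #{n | c.assignPull a (c.assignSlot m (a m) i) n = c.commArm m} :=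
    Finset.one_lt_card.2 ⟨m, by simpa using h2, c.leader, by simpa using h1, hm⟩
  simp only [received, collision, h2]
  rw [if_pos hcol]
  ring

/-! #### Exponential weights over meta-arms -/

/-- The unnormalized weight `exp(-η ∑_{k ∈ A} L k)` of the meta-arm `A`. -/
def weight (L : Fin c.K → ℝ) (A : c.MetaArm) : ℝ := Real.exp (-c.η * ∑ k ∈ A.1, L k)

/-- The probability `P_A` of the meta-arm `A` under the cumulative loss estimates `L`. -/
def metaProb (L : Fin c.K → ℝ) (A : c.MetaArm) : ℝ := c.weight L A / ∑ J, c.weight L J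

/-- The probability `∑_{A ∋ k} P_A` that arm `k` belongs to the chosen meta-arm. -/
def marginal (L : Fin c.K → ℝ) (k : Fin c.K) : ℝ := ∑ A : c.MetaArm with k ∈ A.1, c.metaProb L A

instance : Nonempty c.MetaArm := by
  obtain ⟨A, -, hA⟩ := Finset.exists_subset_card_eq
    (s := (Finset.univ : Finset (Fin c.K))) (n := c.M) (by simpa using c.M_le_K)
  exact ⟨⟨A, hA⟩⟩

theorem weight_sum_pos (L : Fin c.K → ℝ) : 0 < ∑ J, c.weight L J :=
  Finset.sum_pos (fun _ _ => Real.exp_pos _) Finset.univ_nonempty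

/-- The law of the meta-arm. -/
def metaLaw (L : Fin c.K → ℝ) : PMF c.MetaArm :=
  PMF.ofFintype (fun A => ENNReal.ofReal (c.metaProb L A)) (by
    have h0 : ∀ A ∈ Finset.univ, 0 ≤ c.metaProb L A := fun A _ =>
      div_nonneg (Real.exp_pos _).le (c.weight_sum_pos L).le
    rw [← ENNReal.ofReal_sum_of_nonneg h0]
    simp only [metaProb]
    rw [← Finset.sum_div, div_self (c.weight_sum_pos L).ne', ENNReal.ofReal_one])

/-- The law of the assignment: a meta-arm is drawn, and its arms are permuted uniformly at
random. -/
def assignLaw (L : Fin c.K → ℝ) : PMF c.Assignment :=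
  (c.metaLaw L).bind fun A =>
    (PMF.uniformOfFintype (Equiv.Perm (Fin c.M))).map fun σ =>
      σ.toEmbedding.trans (A.1.orderEmbOfFin A.2).toEmbedding

/-- The law of the choices in phase `p`.  The uniform law on the product of the sets `exploreSet`
means that the players choose independently and uniformly. -/
def phaseLaw (p : ℕ) (L : Fin c.K → ℝ) : PMF c.Outcome :=
  (c.assignLaw L).bind fun a =>
    (PMF.uniformOfFinset (Fintype.piFinset (c.exploreSet l p a))
      ⟨a, Fintype.mem_piFinset.2 (c.mem_exploreSet l p a)⟩).map fun e => (a, e)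

/-- The cumulative loss that the leader receives in the exploration phase `p`. -/
def leaderLoss (p : ℕ) (o : c.Outcome) : ℝ :=
  ∑ i : Fin c.τ, received (l (p * c.phaseLen + (c.commLen + i))) o.2 c.leader

/-- The loss estimate of arm `k` after phase `p`; it is `0` if the leader has decoded the flag
`F = 1`. -/
def lossEstimate (p : ℕ) (L : Fin c.K → ℝ) (o : c.Outcome) (k : Fin c.K) : ℝ :=
  if c.leaderFlag l p o.1 then 0
  else (c.M : ℝ) / c.τ * (c.leaderLoss l p o * (if o.1 c.leader = k then 1 else 0) / c.marginal L k)

/-- The cumulative loss estimates after the first `n` phases. -/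
def cumEstimate : (n : ℕ) → (Fin n → c.Outcome) → Fin c.K → ℝ
  | 0, _ => 0
  | n + 1, h => cumEstimate n (Fin.init h) +
      c.lossEstimate l n (cumEstimate n (Fin.init h)) (h (Fin.last n))

/-- The joint law of the choices in the first `n` phases. -/
def law : (n : ℕ) → PMF (Fin n → c.Outcome)
  | 0 => PMF.pure Fin.elim0
  | n + 1 => (law n).bind fun h =>
      (c.phaseLaw l n (c.cumEstimate l n h)).map fun o => Fin.snoc (α := fun _ => c.Outcome) h o

/-- The pulls in slot `o < phaseLen` of phase `p`. -/
def phasePull (p : ℕ) (x : c.Outcome) (o : ℕ) : Fin c.M → Fin c.K :=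
  if o < c.assignLen then c.assignPull x.1 o
  else if o < c.commLen then c.reportPull l p x.1
  else x.2

/-- A number of phases that covers the slots `0, …, T - 1`. -/
def numPhases (T : ℕ) : ℕ := T / c.phaseLen + 1

/-- The phase that contains slot `t`. -/
def phaseOf {T : ℕ} (t : Fin T) : Fin (c.numPhases T) :=
  ⟨t / c.phaseLen, Nat.lt_succ_of_le (Nat.div_le_div_right t.2.le)⟩

/-- The pulls in the slots `0, …, T - 1`. -/
def pulls (T : ℕ) (h : Fin (c.numPhases T) → c.Outcome) (t : Fin T) : Fin c.M → Fin c.K :=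
  c.phasePull l (t / c.phaseLen) (h (c.phaseOf t)) (t % c.phaseLen)

/-- The expected regret over `T` slots. -/
def expectedRegret (T : ℕ) : ℝ :=
  ∑ h : Fin (c.numPhases T) → c.Outcome,
    (c.law l (c.numPhases T) h).toReal * regret l T (c.pulls l T h)

/-- The number of failed communication phases within the first `T` slots: some follower detects an
error, or the leader decodes `F = 1`. -/
def numFailed (T : ℕ) (h : Fin (c.numPhases T) → c.Outcome) : ℕ :=
  #{p : Fin (c.numPhases T) | p * c.phaseLen + c.commLen ≤ T ∧
      ((∃ m, m ≠ c.leader ∧ c.followerFlag l p (h p).1 m) ∨ c.leaderFlag l p (h p).1)}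

end Params

/-- The exponent `ν = max {(3β - 1)/2, 0}` of the code length. -/
def nu (β : ℝ) : ℝ := max ((3 * β - 1) / 2) 0

/-- The exploration length `τ = ⌈K^{1/3} log(K)^{-1/3} T^{max {β, 1/3}}⌉`. -/
def exploreLen (K T : ℕ) (β : ℝ) : ℕ :=
  ⌈(K : ℝ) ^ (1 / 3 : ℝ) * Real.log K ^ (-(1 / 3) : ℝ) * (T : ℝ) ^ max β (1 / 3)⌉₊

/-- The β-aware algorithm for horizon `T`, with every bit repeated `rep` times. -/
def betaAware (M K : ℕ) (hM : 1 < M) (hMK : M ≤ K) (β : ℝ) (T rep : ℕ) : Params where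
  M := M
  K := K
  one_lt_M := hM
  M_le_K := hMK
  rep := rep
  τ := exploreLen K T β
  η := Real.sqrt (Real.log (K.choose M) * exploreLen K T β / (M * K * T))

end

end A2C2

/-! A bit 1 is sent by a collision and is always received. Only a bit 0 can be corrupted, and only
when the receiver's communication arm has loss 1 in all r repetitions. Whether a phase is `Attacked`
in this sense depends on the losses alone, not on the random choices. Phases occupy disjoint slots,
so each communication arm is attacked in at most V(T)/r completed communication phases, and all M
arms together in at most M V(T)/r (`rep_mul_card_exists_attacked_le`). Every failed phase is
attacked, which gives the bound on failures in every realization.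

In an unattacked phase the players explore the drawn assignment without collisions. The leader's arm
is k with probability (1/M) ∑_{A ∋ k} P_A, so her importance-weighted estimate is unbiased.
Exponential weights are analysed through `potential`: it is nonnegative, starts at log(K choose
M)/η, and its expected change plus the expected exploration regret divided by τ is at most ηKM
(`expect_drift_le_of_not_attacked`). In an attacked phase the estimate may be wrong, but it still
records a loss in [0,1] for one arm, and the excess is at most 2M (`expect_drift_le`). Since both
bounds hold for every past, they telescope over the phases (`expect_law_sum_le`).

Multiplying by τ and charging M for each communication slot and for each slot of the incomplete last
phase gives `betaAware_expectedRegret_le`. The choices of η, τ and ν then balance communication,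
exploration and failures (`regret_terms_le`). The case M = K is separate, because there η = 0. -/

namespace A2C2

open Classical Finset

noncomputable section

/-! ### Expectations over finite probability spaces -/

/-- The expectation of `f` under the law `μ` on a finite type. -/
def expect {α : Type*} [Fintype α] (μ : PMF α) (f : α → ℝ) : ℝ := ∑ a, (μ a).toReal * f a

section expect

variable {α β : Type*} [Fintype α] [Fintype β]

theorem sum_toReal (μ : PMF α) : ∑ a, (μ a).toReal = 1 := by
  rw [← ENNReal.toReal_sum fun a _ => μ.apply_ne_top a, ← tsum_fintype (L := .unconditional _),
    μ.tsum_coe, ENNReal.toReal_one]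

theorem expect_const (μ : PMF α) (x : ℝ) : expect μ (fun _ => x) = x := by
  rw [expect, ← Finset.sum_mul, sum_toReal, one_mul]

theorem expect_add (μ : PMF α) (f g : α → ℝ) :
    expect μ (fun a => f a + g a) = expect μ f + expect μ g := by
  simp only [expect, mul_add, Finset.sum_add_distrib]

theorem expect_const_mul (μ : PMF α) (x : ℝ) (f : α → ℝ) :
    expect μ (fun a => x * f a) = x * expect μ f := by
  simp only [expect, Finset.mul_sum]
  exact Finset.sum_congr rfl fun _ _ => by ring

theorem expect_sum {ι : Type*} (μ : PMF α) (s : Finset ι) (f : ι → α → ℝ) :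
    expect μ (fun a => ∑ i ∈ s, f i a) = ∑ i ∈ s, expect μ (f i) := by
  simp only [expect, Finset.mul_sum]
  exact Finset.sum_comm

theorem expect_mono_support {μ : PMF α} {f g : α → ℝ} (h : ∀ a ∈ μ.support, f a ≤ g a) :
    expect μ f ≤ expect μ g := by
  refine Finset.sum_le_sum fun a _ => ?_
  by_cases ha : a ∈ μ.support
  · exact mul_le_mul_of_nonneg_left (h a ha) ENNReal.toReal_nonneg
  · rw [PMF.mem_support_iff, not_not] at ha
    simp [ha]

theorem expect_mono {μ : PMF α} {f g : α → ℝ} (h : ∀ a, f a ≤ g a) :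
    expect μ f ≤ expect μ g := expect_mono_support fun a _ => h a

theorem expect_pure (a : α) (f : α → ℝ) : expect (PMF.pure a) f = f a := by
  simp [expect, PMF.pure_apply, apply_ite ENNReal.toReal]

theorem expect_bind (μ : PMF α) (κ : α → PMF β) (f : β → ℝ) :
    expect (μ.bind κ) f = expect μ fun a => expect (κ a) f := by
  have h : ∀ b, (μ.bind κ b).toReal = ∑ a, (μ a).toReal * (κ a b).toReal := fun b => by
    rw [PMF.bind_apply, tsum_fintype, ENNReal.toReal_sum fun a _ =>
      ENNReal.mul_ne_top (μ.apply_ne_top a) ((κ a).apply_ne_top b)]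
    simp only [ENNReal.toReal_mul]
  simp only [expect, h, Finset.sum_mul, Finset.mul_sum]
  rw [Finset.sum_comm]
  exact Finset.sum_congr rfl fun _ _ => Finset.sum_congr rfl fun _ _ => by ring

theorem expect_map (μ : PMF α) (φ : α → β) (f : β → ℝ) :
    expect (μ.map φ) f = expect μ fun a => f (φ a) := by
  rw [PMF.map, expect_bind]
  simp only [Function.comp_apply, expect_pure]

theorem expect_uniformOfFintype [Nonempty α] (f : α → ℝ) :
    expect (PMF.uniformOfFintype α) f = (∑ a, f a) / Fintype.card α := by
  simp only [expect, PMF.uniformOfFintype_apply, ENNReal.toReal_inv, ENNReal.toReal_natCast]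
  rw [← Finset.mul_sum, div_eq_inv_mul]

end expect

/-- The image of a point under a uniformly random permutation is uniform. -/
theorem expect_uniform_perm {n : ℕ} (i : Fin n) (g : Fin n → ℝ) :
    expect (PMF.uniformOfFintype (Equiv.Perm (Fin n))) (fun σ => g (σ i)) = (∑ j, g j) / n := by
  have hn : (n : ℝ) ≠ 0 := by have := i.pos; positivity
  -- Right multiplication by the transposition of i and j permutes the group, so the position is
  -- irrelevant; summing over all positions gives ∑ g for each permutation.
  have hsymm : ∀ j, ∑ σ : Equiv.Perm (Fin n), g (σ j) = ∑ σ : Equiv.Perm (Fin n), g (σ i) := by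
    intro j
    refine Fintype.sum_equiv (Equiv.mulRight (Equiv.swap i j)) _ _ fun σ => ?_
    simp
  have htot : (n : ℝ) * ∑ σ : Equiv.Perm (Fin n), g (σ i)
      = Fintype.card (Equiv.Perm (Fin n)) * ∑ j, g j := by
    calc (n : ℝ) * ∑ σ : Equiv.Perm (Fin n), g (σ i)
        = ∑ j, ∑ σ : Equiv.Perm (Fin n), g (σ j) := by simp [hsymm]
      _ = ∑ σ : Equiv.Perm (Fin n), ∑ j, g (σ j) := Finset.sum_comm
      _ = ∑ _σ : Equiv.Perm (Fin n), ∑ j, g j :=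
          Finset.sum_congr rfl fun σ _ => Equiv.sum_comp σ g
      _ = _ := by simp
  have hc : (Fintype.card (Equiv.Perm (Fin n)) : ℝ) ≠ 0 := by
    exact_mod_cast Fintype.card_ne_zero
  rw [expect_uniformOfFintype, div_eq_div_iff hc hn]
  linarith

/-! ### Received losses -/

theorem received_of_injective {M K : ℕ} (loss : Fin K → ℝ) {π : Fin M → Fin K}
    (hπ : Function.Injective π) (m : Fin M) : received loss π m = loss (π m) := by
  have h : ¬ 1 < #{n | π n = π m} := by
    rw [not_lt, Finset.card_le_one]
    intro a ha b hb
    rw [Finset.mem_filter] at ha hb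
    exact hπ (ha.2.trans hb.2.symm)
  simp [received, collision, h]

theorem collision_eq_zero_or_one {M K : ℕ} (π : Fin M → Fin K) (k : Fin K) :
    collision π k = 0 ∨ collision π k = 1 := by
  unfold collision
  split_ifs <;> simp

theorem received_mem_Icc {M K : ℕ} {loss : Fin K → ℝ} (hl : ∀ k, 0 ≤ loss k ∧ loss k ≤ 1)
    (π : Fin M → Fin K) (m : Fin M) :
    0 ≤ received loss π m ∧ received loss π m ≤ 1 := by
  unfold received
  rcases collision_eq_zero_or_one π (π m) with h | h <;> simp [h, hl]

namespace Params

variable (c : Params)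

/-! ### The law of the assignment -/

theorem metaProb_pos (L : Fin c.K → ℝ) (A : c.MetaArm) : 0 < c.metaProb L A :=
  div_pos (Real.exp_pos _) (c.weight_sum_pos L)

theorem sum_metaProb (L : Fin c.K → ℝ) : ∑ A, c.metaProb L A = 1 := by
  simp only [metaProb]
  rw [← Finset.sum_div, div_self (c.weight_sum_pos L).ne']

theorem marginal_pos (L : Fin c.K → ℝ) (k : Fin c.K) : 0 < c.marginal L k := by
  have hM : 1 ≤ c.M := c.one_lt_M.le
  obtain ⟨A, hkA, -, hA⟩ := Finset.exists_subsuperset_card_eq (Finset.subset_univ {k})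
    (n := c.M) (by simpa using hM) (by simpa using c.M_le_K)
  refine Finset.sum_pos (fun A _ => c.metaProb_pos L A) ⟨⟨A, hA⟩, ?_⟩
  rw [Finset.mem_filter]
  exact ⟨Finset.mem_univ _, hkA (Finset.mem_singleton_self k)⟩

theorem sum_marginal_mul (L f : Fin c.K → ℝ) :
    ∑ k, c.marginal L k * f k = ∑ A, c.metaProb L A * ∑ k ∈ A.1, f k := by
  simp only [marginal, Finset.sum_mul, Finset.mul_sum, Finset.sum_filter]
  rw [Finset.sum_comm]
  refine Finset.sum_congr rfl fun A _ => ?_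
  rw [← Finset.sum_subset (Finset.subset_univ A.1)]
  · exact Finset.sum_congr rfl fun k hk => by simp [hk]
  · intro k _ hk
    simp [hk]

theorem expect_metaLaw (L : Fin c.K → ℝ) (f : c.MetaArm → ℝ) :
    expect (c.metaLaw L) f = ∑ A, c.metaProb L A * f A := by
  simp only [expect, metaLaw, PMF.ofFintype_apply,
    ENNReal.toReal_ofReal (c.metaProb_pos L _).le]

/-- Given the meta-arm A, the arm of any one player is uniform in A, which explains the factor 1/M.
Only these one-player laws are needed later; the joint law is not. -/
theorem expect_assignLaw (L : Fin c.K → ℝ) (m : Fin c.M) (f : Fin c.K → ℝ) :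
    expect (c.assignLaw L) (fun a => f (a m)) = (∑ k, c.marginal L k * f k) / c.M := by
  rw [assignLaw, expect_bind, expect_metaLaw, sum_marginal_mul, Finset.sum_div]
  refine Finset.sum_congr rfl fun A _ => ?_
  rw [expect_map, mul_div_assoc]
  congr 1
  have h := expect_uniform_perm m fun j => f (A.1.orderEmbOfFin A.2 j)
  have h2 : ∑ j, f (A.1.orderEmbOfFin A.2 j) = ∑ k ∈ A.1, f k := by
    conv_rhs => rw [← Finset.map_orderEmbOfFin_univ A.1 A.2]
    rw [Finset.sum_map]
    rfl
  rw [← h2, ← h]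
  rfl

variable (l : ℕ → Fin c.K → ℝ)

theorem expect_phaseLaw_fst (p : ℕ) (L : Fin c.K → ℝ) (f : c.Assignment → ℝ) :
    expect (c.phaseLaw l p L) (fun o => f o.1) = expect (c.assignLaw L) f := by
  rw [phaseLaw, expect_bind]
  congr 1
  funext a
  rw [expect_map]
  exact expect_const (α := Fin c.M → Fin c.K) _ (f a)

theorem mem_exploreSet_of_mem_support {p : ℕ} {L : Fin c.K → ℝ} {o : c.Outcome}
    (ho : o ∈ (c.phaseLaw l p L).support) (m : Fin c.M) : o.2 m ∈ c.exploreSet l p o.1 m := by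
  rw [phaseLaw, PMF.mem_support_bind_iff] at ho
  obtain ⟨a, -, ho⟩ := ho
  rw [PMF.mem_support_map_iff] at ho
  obtain ⟨e, he, rfl⟩ := ho
  exact Fintype.mem_piFinset.1 ((PMF.mem_support_uniformOfFinset_iff _ _).1 he) m

theorem expect_law_succ (n : ℕ) (f : (Fin (n + 1) → c.Outcome) → ℝ) :
    expect (c.law l (n + 1)) f = expect (c.law l n) fun h =>
      expect (c.phaseLaw l n (c.cumEstimate l n h)) fun o =>
        f (Fin.snoc (α := fun _ => c.Outcome) h o) := by
  rw [law, expect_bind]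
  simp only [expect_map]

/-! ### Communication errors require attacked slots -/

/-- In phase `p` the losses on the communication arm of player `m` are `1` in some `rep` slots of
the communication phase. -/
def Attacked (p : ℕ) (m : Fin c.M) : Prop :=
  ∃ s : Fin c.rep → ℕ, Function.Injective s ∧ (∀ i, s i < c.commLen) ∧
    ∀ i, l (p * c.phaseLen + s i) (c.commArm m) = 1

theorem commArm_injective : Function.Injective c.commArm := Fin.castLE_injective c.M_le_K

theorem pos_of_ne_leader {m : Fin c.M} (hm : m ≠ c.leader) : 0 < (m : ℕ) :=
  Nat.pos_of_ne_zero fun h => hm (Fin.ext h)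

theorem assignSlot_div (m : Fin c.M) (j : Fin c.K) (i : Fin c.rep) :
    c.assignSlot m j i / c.rep = ((m : ℕ) - 1) * c.K + j := by
  rw [assignSlot, mul_comm, Nat.mul_add_div i.pos, Nat.div_eq_of_lt i.2, add_zero]

theorem receiver_assignSlot {m : Fin c.M} (hm : m ≠ c.leader) (j : Fin c.K) (i : Fin c.rep) :
    c.receiver (c.assignSlot m j i) = m := by
  have := c.pos_of_ne_leader hm
  rw [receiver, assignSlot_div, mul_comm, Nat.mul_add_div c.K_pos, Nat.div_eq_of_lt j.2]
  omega

theorem block_assignSlot (m : Fin c.M) (j : Fin c.K) (i : Fin c.rep) :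
    c.block (c.assignSlot m j i) = j := by
  apply Fin.ext
  simp only [block]
  rw [assignSlot_div, mul_comm, Nat.mul_add_mod, Nat.mod_eq_of_lt j.2]

theorem assignSlot_lt {m : Fin c.M} (hm : m ≠ c.leader) (j : Fin c.K) (i : Fin c.rep) :
    c.assignSlot m j i < c.assignLen := by
  have hm0 := c.pos_of_ne_leader hm
  have h1 : ((m : ℕ) - 1) * c.K + j + 1 ≤ (c.M - 1) * c.K := by
    have h2 : ((m : ℕ) - 1 + 1) * c.K ≤ (c.M - 1) * c.K := Nat.mul_le_mul_right _ (by omega)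
    have := j.2
    rw [Nat.succ_mul] at h2
    omega
  have h3 := Nat.mul_le_mul_right c.rep h1
  rw [Nat.succ_mul] at h3
  have := i.2
  unfold assignSlot assignLen
  omega

theorem assignPull_assignSlot {a : c.Assignment} {m : Fin c.M} (hm : m ≠ c.leader) {j : Fin c.K}
    (hj : j ≠ a m) (i : Fin c.rep) : c.assignPull a (c.assignSlot m j i) = c.commArm := by
  funext n
  have hlt : c.receiver (c.assignSlot m j i) < c.M := by
    rw [c.receiver_assignSlot hm]
    exact m.2
  have hm' : (⟨c.receiver (c.assignSlot m j i), hlt⟩ : Fin c.M) = m :=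
    Fin.ext (c.receiver_assignSlot hm j i)
  unfold assignPull
  split_ifs with h1 h2
  · rw [hm', block_assignSlot] at h2
    exact absurd h2 hj
  · rw [h1]
  · rfl

variable {l}

/-- During a block other than the assigned one all players sit on their own communication arms.
There is no collision, so a received loss 1 is a true loss 1. -/
theorem attacked_of_mem_decoded {p : ℕ} {a : c.Assignment} {m : Fin c.M} (hm : m ≠ c.leader)
    {j : Fin c.K} (hj : j ∈ c.decoded l p a m) (hja : j ≠ a m) : c.Attacked l p m := by
  refine ⟨c.assignSlot m j, fun i i' h => Fin.ext (Nat.add_left_cancel h), fun i =>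
    (c.assignSlot_lt hm j i).trans_le (Nat.le_add_right _ _), fun i => ?_⟩
  simp only [decoded, eDecoder, Finset.mem_filter, Finset.mem_univ, true_and] at hj
  have h := hj i
  rwa [c.assignPull_assignSlot hm hja, received_of_injective _ c.commArm_injective] at h

theorem attacked_of_followerFlag {p : ℕ} {a : c.Assignment} {m : Fin c.M} (hm : m ≠ c.leader)
    (h : c.followerFlag l p a m) : c.Attacked l p m := by
  obtain ⟨j, hj, hja⟩ := Finset.exists_mem_ne h (a m)
  exact c.attacked_of_mem_decoded hm hj hja

theorem attacked_of_leaderFlag {p : ℕ} {a : c.Assignment}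
    (hf : ∀ m, m ≠ c.leader → ¬ c.followerFlag l p a m) (h : c.leaderFlag l p a) :
    c.Attacked l p c.leader := by
  have hpull : c.reportPull l p a = c.commArm := by
    funext m
    exact if_neg fun hm => hf m hm.1 hm.2
  refine ⟨fun i => c.assignLen + i, fun i i' h => Fin.ext (Nat.add_left_cancel h),
    fun i => Nat.add_lt_add_left i.2 _, fun i => ?_⟩
  have := h i
  simp only at this
  rwa [hpull, received_of_injective _ c.commArm_injective] at this

/-- If no follower raises a flag, nobody joins the leader during the report, so F = 1 can only come
from true losses on her communication arm. -/
theorem exists_attacked_of_failed {p : ℕ} {a : c.Assignment}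
    (h : (∃ m, m ≠ c.leader ∧ c.followerFlag l p a m) ∨ c.leaderFlag l p a) :
    ∃ m, c.Attacked l p m := by
  by_cases hf : ∃ m, m ≠ c.leader ∧ c.followerFlag l p a m
  · obtain ⟨m, hm, hfm⟩ := hf
    exact ⟨m, c.attacked_of_followerFlag hm hfm⟩
  · push Not at hf
    exact ⟨_, c.attacked_of_leaderFlag hf (h.resolve_left (by push Not; exact hf))⟩

theorem exploreSet_eq_singleton {p : ℕ} (h : ¬ ∃ m, c.Attacked l p m) (a : c.Assignment)
    (m : Fin c.M) : c.exploreSet l p a m = {a m} := by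
  refine Finset.eq_singleton_iff_unique_mem.2 ⟨c.mem_exploreSet l p a m, fun j hj => ?_⟩
  unfold exploreSet at hj
  split_ifs at hj with hm
  · rw [hm]
    exact Finset.mem_singleton.1 hj
  · by_contra hja
    exact h ⟨m, c.attacked_of_mem_decoded hm hj hja⟩

/-- The number of phases with a communication phase completed in the first `T` slots in which the
communication arm of `m` is attacked. -/
theorem rep_mul_card_attacked_le (T n : ℕ) (m : Fin c.M) :
    c.rep * #{p ∈ Finset.range n | p * c.phaseLen + c.commLen ≤ T ∧ c.Attacked l p m}
      ≤ globalAttackability l T := by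
  set S := {p ∈ Finset.range n | p * c.phaseLen + c.commLen ≤ T ∧ c.Attacked l p m} with hS
  have hatt : ∀ p ∈ S, p * c.phaseLen + c.commLen ≤ T ∧ c.Attacked l p m := fun p hp =>
    (Finset.mem_filter.1 hp).2
  have hex : ∀ p, ∃ s : Fin c.rep → ℕ, p ∈ S → Function.Injective s ∧ (∀ i, s i < c.commLen) ∧
      ∀ i, l (p * c.phaseLen + s i) (c.commArm m) = 1 := by
    intro p
    by_cases hp : p ∈ S
    · obtain ⟨s, hs⟩ := (hatt p hp).2
      exact ⟨s, fun _ => hs⟩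
    -- A default outside S, where nothing is required of the slots.
    · exact ⟨fun _ => 0, fun h => absurd h hp⟩
  choose s hs using hex
  refine le_trans ?_ (Finset.le_sup (f := fun k : Fin c.K => #{t ∈ Finset.range T | l t k = 1})
    (Finset.mem_univ (c.commArm m)))
  have hcard : c.rep * #S = #(S ×ˢ (Finset.univ : Finset (Fin c.rep))) := by
    rw [Finset.card_product, Finset.card_univ, Fintype.card_fin, mul_comm]
  rw [hcard]
  have hle : c.commLen ≤ c.phaseLen := Nat.le_add_right _ _
  -- Each pair of an attacked phase and a repetition is sent to an attacked slot. Division by the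
  -- phase length recovers the phase, and injectivity within the phase recovers the repetition.
  refine Finset.card_le_card_of_injOn (fun x => x.1 * c.phaseLen + s x.1 x.2) ?_ ?_
  · rintro ⟨p, i⟩ hx
    have hp : p ∈ S := (Finset.mem_product.1 hx).1
    have h1 := (hs p hp).2.1 i
    have h2 := (hatt p hp).1
    simp only [Finset.coe_filter, Set.mem_ofPred_eq, Finset.mem_range]
    exact ⟨by omega, (hs p hp).2.2 i⟩
  · rintro ⟨p, i⟩ hx ⟨q, j⟩ hy hxy
    have hp : p ∈ S := (Finset.mem_product.1 hx).1
    have hq : q ∈ S := (Finset.mem_product.1 hy).1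
    have h1 := ((hs p hp).2.1 i).trans_le hle
    have h2 := ((hs q hq).2.1 j).trans_le hle
    have hpos : 0 < c.phaseLen := by omega
    simp only at hxy
    have hpq : p = q := by
      have h := congrArg (· / c.phaseLen) hxy
      simp only [mul_comm _ c.phaseLen, Nat.mul_add_div hpos, Nat.div_eq_of_lt h1,
        Nat.div_eq_of_lt h2] at h
      simpa using h
    subst hpq
    rw [(hs p hp).1 (Nat.add_left_cancel hxy)]

theorem rep_mul_card_exists_attacked_le (T n : ℕ) :
    c.rep * #{p ∈ Finset.range n | p * c.phaseLen + c.commLen ≤ T ∧ ∃ m, c.Attacked l p m}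
      ≤ c.M * globalAttackability l T := by
  have hsub : {p ∈ Finset.range n | p * c.phaseLen + c.commLen ≤ T ∧ ∃ m, c.Attacked l p m} ⊆
      Finset.univ.biUnion fun m =>
        {p ∈ Finset.range n | p * c.phaseLen + c.commLen ≤ T ∧ c.Attacked l p m} := by
    intro p hp
    obtain ⟨hp, hT, m, hm⟩ := Finset.mem_filter.1 hp
    exact Finset.mem_biUnion.2 ⟨m, Finset.mem_univ m, Finset.mem_filter.2 ⟨hp, hT, hm⟩⟩
  calc _ ≤ c.rep * ∑ m : Fin c.M,
        #{p ∈ Finset.range n | p * c.phaseLen + c.commLen ≤ T ∧ c.Attacked l p m} :=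
        Nat.mul_le_mul_left _ ((Finset.card_le_card hsub).trans Finset.card_biUnion_le)
    _ ≤ ∑ _m : Fin c.M, globalAttackability l T := by
        rw [Finset.mul_sum]
        exact Finset.sum_le_sum fun m _ => c.rep_mul_card_attacked_le T n m
    _ = _ := by simp

theorem rep_mul_numFailed_le (T : ℕ) (h : Fin (c.numPhases T) → c.Outcome) :
    c.rep * c.numFailed l T h ≤ c.M * globalAttackability l T := by
  refine le_trans (Nat.mul_le_mul_left _ ?_)
    (c.rep_mul_card_exists_attacked_le (l := l) T (c.numPhases T))
  refine Finset.card_le_card_of_injOn (fun p => (p : ℕ)) ?_ (Fin.val_injective.injOn)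
  intro p hp
  simp only [Finset.coe_filter, Set.mem_ofPred_eq, Finset.mem_univ, true_and] at hp
  simp only [Finset.coe_filter, Set.mem_ofPred_eq, Finset.mem_range]
  exact ⟨p.2, hp.1, c.exists_attacked_of_failed hp.2⟩

end Params

-- From exp(-x) ≤ 1/(1 + x) and (1 + x)(1 - x + x²) = 1 + x³. There is no upper limit on x, as
-- importance-weighted estimates can be large.
theorem exp_neg_le_one_sub_add_sq {x : ℝ} (hx : 0 ≤ x) : Real.exp (-x) ≤ 1 - x + x ^ 2 := by
  have h1 : 0 < 1 + x := by linarith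
  have h2 : 1 + x ≤ Real.exp x := by linarith [Real.add_one_le_exp x]
  rw [Real.exp_neg]
  refine (inv_anti₀ h1 h2).trans ?_
  rw [inv_le_iff_one_le_mul₀ h1]
  nlinarith [pow_nonneg hx 3]

namespace Params

variable (c : Params)

/-! ### The exponential weights potential -/

/-- The estimated cumulative loss of the assignment `B`, plus the normalized log-partition
function. -/
def potential (B : c.Assignment) (L : Fin c.K → ℝ) : ℝ :=
  ∑ m, L (B m) + Real.log (∑ A, c.weight L A) / c.η

/-- The partition function contains the weight of the image of B, whose logarithm cancels the
estimated loss of B. -/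
theorem potential_nonneg (hη : 0 < c.η) (B : c.Assignment) (L : Fin c.K → ℝ) :
    0 ≤ c.potential B L := by
  have hA : #(Finset.univ.map B) = c.M := by simp
  have h1 : c.weight L ⟨Finset.univ.map B, hA⟩ ≤ ∑ A, c.weight L A :=
    Finset.single_le_sum (f := c.weight L) (fun A _ => (Real.exp_pos _).le) (Finset.mem_univ _)
  have h2 := Real.log_le_log (Real.exp_pos _) h1
  rw [Real.log_exp, Finset.sum_map] at h2
  have h3 := (le_div_iff₀ hη).2 (show -(∑ m, L (B m)) * c.η ≤ _ by linarith)
  unfold potential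
  linarith

theorem potential_zero (B : c.Assignment) :
    c.potential B 0 = Real.log (c.K.choose c.M) / c.η := by
  simp [potential, weight]

theorem weight_add_single (L : Fin c.K → ℝ) (k₀ : Fin c.K) (q : ℝ) (A : c.MetaArm) :
    c.weight (L + fun k => if k₀ = k then q else 0) A
      = c.weight L A * Real.exp (-(c.η * if k₀ ∈ A.1 then q else 0)) := by
  rw [weight, weight, ← Real.exp_add]
  congr 1
  simp only [Pi.add_apply, Finset.sum_add_distrib, Finset.sum_ite_eq]
  ring

/-- The ratio of the partition functions is the mean of exp(-η q 1{k₀ ∈ A}) for A drawn from P. The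
quadratic bound on the exponential and log x ≤ x - 1 then apply. -/
theorem log_sum_weight_add_single_le (hη : 0 ≤ c.η) (L : Fin c.K → ℝ) (k₀ : Fin c.K) {q : ℝ}
    (hq : 0 ≤ q) :
    Real.log (∑ A, c.weight (L + fun k => if k₀ = k then q else 0) A)
      ≤ Real.log (∑ A, c.weight L A) + c.marginal L k₀ * (-(c.η * q) + (c.η * q) ^ 2) := by
  have hW := c.weight_sum_pos L
  have hW' := c.weight_sum_pos (L + fun k => if k₀ = k then q else 0)
  have hratio : (∑ A, c.weight (L + fun k => if k₀ = k then q else 0) A) / ∑ A, c.weight L A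
      ≤ 1 + c.marginal L k₀ * (-(c.η * q) + (c.η * q) ^ 2) := by
    calc _ = ∑ A, c.metaProb L A * Real.exp (-(c.η * if k₀ ∈ A.1 then q else 0)) := by
          rw [Finset.sum_div]
          refine Finset.sum_congr rfl fun A _ => ?_
          rw [weight_add_single, metaProb]
          ring
      _ ≤ ∑ A, (c.metaProb L A +
            if k₀ ∈ A.1 then c.metaProb L A * (-(c.η * q) + (c.η * q) ^ 2) else 0) := by
          refine Finset.sum_le_sum fun A _ => ?_
          have hP := (c.metaProb_pos L A).le
          split_ifs with hk
          · have := mul_le_mul_of_nonneg_left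
              (exp_neg_le_one_sub_add_sq (mul_nonneg hη hq)) hP
            linarith
          · simp
      _ = _ := by
          rw [Finset.sum_add_distrib, sum_metaProb, marginal, ← Finset.sum_filter,
            Finset.sum_mul]
  have h := Real.log_le_sub_one_of_pos (div_pos hW' hW)
  rw [Real.log_div hW'.ne' hW.ne'] at h
  linarith

theorem potential_add_single_le (hη : 0 < c.η) (B : c.Assignment) (L : Fin c.K → ℝ)
    (k₀ : Fin c.K) {q : ℝ} (hq : 0 ≤ q) :
    c.potential B (L + fun k => if k₀ = k then q else 0)
      ≤ c.potential B L + (∑ m, if k₀ = B m then q else 0) - q * c.marginal L k₀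
        + c.η * (q ^ 2 * c.marginal L k₀) := by
  have h := div_le_div_of_nonneg_right (c.log_sum_weight_add_single_le hη.le L k₀ hq) hη.le
  have h2 : (Real.log (∑ A, c.weight L A) + c.marginal L k₀ * (-(c.η * q) + (c.η * q) ^ 2)) / c.η
      = Real.log (∑ A, c.weight L A) / c.η - q * c.marginal L k₀
        + c.η * (q ^ 2 * c.marginal L k₀) := by
    field_simp
    ring
  rw [h2] at h
  simp only [potential, Pi.add_apply, Finset.sum_add_distrib]
  linarith

/-! ### The loss estimates -/

variable (l : ℕ → Fin c.K → ℝ)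

/-- The average loss of arm `k` during the exploration phase `p`. -/
def meanLoss (p : ℕ) (k : Fin c.K) : ℝ :=
  (∑ i : Fin c.τ, l (p * c.phaseLen + (c.commLen + i)) k) / c.τ

/-- The loss received by all the players during the exploration phase `p`, relative to the
assignment `B`. -/
def exploreCost (B : c.Assignment) (p : ℕ) (o : c.Outcome) : ℝ :=
  ∑ i : Fin c.τ, (∑ m, received (l (p * c.phaseLen + (c.commLen + i))) o.2 m
    - ∑ m, l (p * c.phaseLen + (c.commLen + i)) (B m))

variable {l}

theorem sum_received_sub_le (hl : ∀ t k, 0 ≤ l t k ∧ l t k ≤ 1) (B : c.Assignment) (t : ℕ)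
    (π : Fin c.M → Fin c.K) : ∑ m, received (l t) π m - ∑ m, l t (B m) ≤ c.M := by
  have h1 : ∑ m, received (l t) π m ≤ ∑ _m : Fin c.M, (1 : ℝ) :=
    Finset.sum_le_sum fun m _ => (received_mem_Icc (hl t) π m).2
  have h2 : 0 ≤ ∑ m, l t (B m) := Finset.sum_nonneg fun m _ => (hl t _).1
  rw [Finset.sum_const, Finset.card_univ, Fintype.card_fin, nsmul_one] at h1
  linarith

theorem exploreCost_le (hl : ∀ t k, 0 ≤ l t k ∧ l t k ≤ 1) (B : c.Assignment) (p : ℕ)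
    (o : c.Outcome) : c.exploreCost l B p o ≤ c.τ * c.M := by
  refine (Finset.sum_le_sum fun i _ => c.sum_received_sub_le hl B _ _).trans ?_
  simp

theorem meanLoss_mem_Icc (hl : ∀ t k, 0 ≤ l t k ∧ l t k ≤ 1) (p : ℕ) (k : Fin c.K) :
    0 ≤ c.meanLoss l p k ∧ c.meanLoss l p k ≤ 1 := by
  refine ⟨div_nonneg (Finset.sum_nonneg fun i _ => (hl _ _).1) (Nat.cast_nonneg _),
    div_le_one_of_le₀ ?_ (Nat.cast_nonneg _)⟩
  refine (Finset.sum_le_sum fun i _ => (hl _ _).2).trans ?_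
  simp

theorem leaderLoss_mem_Icc (hl : ∀ t k, 0 ≤ l t k ∧ l t k ≤ 1) (p : ℕ) (o : c.Outcome) :
    0 ≤ c.leaderLoss l p o ∧ c.leaderLoss l p o ≤ c.τ := by
  refine ⟨Finset.sum_nonneg fun i _ => (received_mem_Icc (hl _) _ _).1, ?_⟩
  refine (Finset.sum_le_sum fun i _ => (received_mem_Icc (hl _) _ _).2).trans ?_
  simp

/-- Only the entry of the leader's arm can be nonzero, the form needed for the one-arm update of the
potential. -/
theorem lossEstimate_eq_single (p : ℕ) (L : Fin c.K → ℝ) (o : c.Outcome) :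
    c.lossEstimate l p L o = fun k => if o.1 c.leader = k then
      (if c.leaderFlag l p o.1 then 0
        else (c.M : ℝ) * (c.leaderLoss l p o / c.τ) / c.marginal L (o.1 c.leader)) else 0 := by
  funext k
  unfold lossEstimate
  split_ifs with h1 h2 h2
  · rfl
  · rfl
  · rw [h2]
    ring
  · simp

theorem snd_eq_of_mem_support {p : ℕ} (hp : ¬ ∃ m, c.Attacked l p m) {L : Fin c.K → ℝ}
    {o : c.Outcome} (ho : o ∈ (c.phaseLaw l p L).support) : o.2 = o.1 := by
  funext m
  have h := c.mem_exploreSet_of_mem_support l ho m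
  rwa [c.exploreSet_eq_singleton hp, Finset.mem_singleton] at h

theorem exploreCost_eq {p : ℕ} {o : c.Outcome} (ho : o.2 = o.1)
    (B : c.Assignment) :
    c.exploreCost l B p o / c.τ = ∑ m, c.meanLoss l p (o.1 m) - ∑ m, c.meanLoss l p (B m) := by
  simp only [exploreCost, meanLoss, ho, received_of_injective _ o.1.injective,
    Finset.sum_sub_distrib, ← Finset.sum_div]
  rw [← sub_div]
  congr 2 <;> exact Finset.sum_comm

theorem leaderLoss_div_eq {p : ℕ} {o : c.Outcome} (ho : o.2 = o.1) :
    c.leaderLoss l p o / c.τ = c.meanLoss l p (o.1 c.leader) := by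
  simp only [leaderLoss, meanLoss, ho, received_of_injective _ o.1.injective]

/-! ### The expected drift of the potential -/

/-- Reduces a drift estimate to a pointwise bound that separates into one function per player and
one function of the leader's arm; both averages are then sums against the marginals. -/
theorem expect_phaseLaw_le {p : ℕ} {L : Fin c.K → ℝ} {F : c.Outcome → ℝ} {y G : Fin c.K → ℝ}
    (h : ∀ o ∈ (c.phaseLaw l p L).support, F o ≤ ∑ m, y (o.1 m) + G (o.1 c.leader)) :
    expect (c.phaseLaw l p L) F
      ≤ ∑ k, c.marginal L k * y k + (∑ k, c.marginal L k * G k) / c.M := by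
  refine (expect_mono_support h).trans (le_of_eq ?_)
  have hM : (c.M : ℝ) ≠ 0 := by have := c.one_lt_M; positivity
  rw [c.expect_phaseLaw_fst l p L fun a => ∑ m, y (a m) + G (a c.leader), expect_add,
    expect_sum, expect_assignLaw]
  simp only [expect_assignLaw, Finset.sum_const, Finset.card_univ, Fintype.card_fin, nsmul_eq_mul]
  field_simp

theorem potential_step_le (hη : 0 < c.η) (B : c.Assignment) (L : Fin c.K → ℝ) (k₀ : Fin c.K)
    {y : ℝ} (hy0 : 0 ≤ y) (hy1 : y ≤ 1) :
    c.potential B (L + fun k => if k₀ = k then (c.M : ℝ) * y / c.marginal L k₀ else 0)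
      ≤ c.potential B L + (∑ m, if k₀ = B m then (c.M : ℝ) * y / c.marginal L k₀ else 0)
        - c.M * y + c.η * ((c.M : ℝ) ^ 2 / c.marginal L k₀) := by
  have hP := c.marginal_pos L k₀
  have hM : (0 : ℝ) ≤ c.M := Nat.cast_nonneg _
  refine (c.potential_add_single_le hη B L k₀ (by positivity)).trans ?_
  have h1 : (c.M : ℝ) * y / c.marginal L k₀ * c.marginal L k₀ = c.M * y := by field_simp
  have h2 : ((c.M : ℝ) * y / c.marginal L k₀) ^ 2 * c.marginal L k₀
      = y ^ 2 * ((c.M : ℝ) ^ 2 / c.marginal L k₀) := by field_simp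
  have h3 : y ^ 2 * ((c.M : ℝ) ^ 2 / c.marginal L k₀) ≤ (c.M : ℝ) ^ 2 / c.marginal L k₀ :=
    mul_le_of_le_one_left (by positivity) (pow_le_one₀ hy0 hy1)
  rw [h1, h2]
  gcongr

theorem sum_marginal_mul_single (L : Fin c.K → ℝ) (B : c.Assignment) (y : Fin c.K → ℝ) :
    ∑ k, c.marginal L k * (∑ m, if k = B m then (c.M : ℝ) * y k / c.marginal L k else 0)
      = c.M * ∑ m, y (B m) := by
  simp only [Finset.mul_sum]
  rw [Finset.sum_comm]
  refine Finset.sum_congr rfl fun m _ => ?_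
  have hP := (c.marginal_pos L (B m)).ne'
  simp only [mul_ite, mul_zero, Finset.sum_ite_eq', Finset.mem_univ, if_true]
  field_simp

theorem sum_marginal_mul_inv (L : Fin c.K → ℝ) :
    ∑ k, c.marginal L k * (c.η * ((c.M : ℝ) ^ 2 / c.marginal L k)) = c.η * c.M ^ 2 * c.K := by
  have h : ∀ k, c.marginal L k * (c.η * ((c.M : ℝ) ^ 2 / c.marginal L k)) = c.η * c.M ^ 2 :=
    fun k => by have hP := (c.marginal_pos L k).ne'; field_simp
  simp only [h, Finset.sum_const, Finset.card_univ, Fintype.card_fin, nsmul_eq_mul]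
  ring

theorem sum_marginal (L : Fin c.K → ℝ) : ∑ k, c.marginal L k = c.M := by
  have h := c.sum_marginal_mul L fun _ => 1
  have h2 : ∀ A : c.MetaArm, ∑ _k ∈ A.1, (1 : ℝ) = c.M := fun A => by simp [A.2]
  simp only [h2, mul_one] at h
  rw [h, ← Finset.sum_mul, sum_metaProb, one_mul]

theorem expect_drift_le_of_not_attacked (hl : ∀ t k, 0 ≤ l t k ∧ l t k ≤ 1) (hη : 0 < c.η)
    (B : c.Assignment) {p : ℕ} (hp : ¬ ∃ m, c.Attacked l p m) (L : Fin c.K → ℝ) :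
    expect (c.phaseLaw l p L) (fun o => c.exploreCost l B p o / c.τ
      + c.potential B (L + c.lossEstimate l p L o)) ≤ c.potential B L + c.η * c.K * c.M := by
  have hM : (c.M : ℝ) ≠ 0 := by have := c.one_lt_M; positivity
  -- After averaging, `- M y` cancels the players' expected loss, and the update of B's estimated
  -- loss cancels `- ∑ m, meanLoss (B m)`. The quadratic term contributes ηKM, since the marginals
  -- cancel for each of the K arms.
  refine (c.expect_phaseLaw_le (y := c.meanLoss l p) (G := fun k =>
    (c.potential B L - ∑ m, c.meanLoss l p (B m)) +
      (∑ m, if k = B m then (c.M : ℝ) * c.meanLoss l p k / c.marginal L k else 0)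
      - c.M * c.meanLoss l p k + c.η * ((c.M : ℝ) ^ 2 / c.marginal L k)) ?_).trans (le_of_eq ?_)
  · intro o ho
    have ho' := c.snd_eq_of_mem_support hp ho
    have hF : ¬ c.leaderFlag l p o.1 := fun h => hp (c.exists_attacked_of_failed (Or.inr h))
    have hy := c.meanLoss_mem_Icc hl p (o.1 c.leader)
    rw [lossEstimate_eq_single, c.exploreCost_eq ho', c.leaderLoss_div_eq ho']
    simp only [hF, if_false]
    linarith [c.potential_step_le hη B L (o.1 c.leader) hy.1 hy.2]
  · simp only [mul_add, mul_sub, Finset.sum_add_distrib, Finset.sum_sub_distrib]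
    rw [sum_marginal_mul_single, sum_marginal_mul_inv, ← Finset.sum_mul, ← Finset.sum_mul,
      sum_marginal]
    have h : ∑ k, c.marginal L k * (c.M * c.meanLoss l p k)
        = c.M * ∑ k, c.marginal L k * c.meanLoss l p k := by
      rw [Finset.mul_sum]
      exact Finset.sum_congr rfl fun _ _ => by ring
    rw [h]
    field_simp
    ring

theorem expect_drift_le (hl : ∀ t k, 0 ≤ l t k ∧ l t k ≤ 1) (hη : 0 < c.η)
    (hτ : 0 < c.τ) (B : c.Assignment) (p : ℕ) (L : Fin c.K → ℝ) :
    expect (c.phaseLaw l p L) (fun o => c.exploreCost l B p o / c.τ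
      + c.potential B (L + c.lossEstimate l p L o))
      ≤ c.potential B L + (2 * c.M + c.η * c.K * c.M) := by
  have hM : (0 : ℝ) < c.M := by have := c.one_lt_M; positivity
  have hτ' : (0 : ℝ) < c.τ := by positivity
  -- One M bounds the exploration cost. The other is the expected increase of B's estimated loss
  -- when the recorded loss is replaced by its maximum 1.
  refine (c.expect_phaseLaw_le (y := fun _ => 0) (G := fun k => (c.potential B L + c.M) +
      (∑ m, if k = B m then (c.M : ℝ) * 1 / c.marginal L k else 0)
      + c.η * ((c.M : ℝ) ^ 2 / c.marginal L k)) ?_).trans (le_of_eq ?_)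
  · intro o _
    have hP := c.marginal_pos L (o.1 c.leader)
    have hcost : c.exploreCost l B p o / c.τ ≤ c.M := by
      rw [div_le_iff₀ hτ', mul_comm]
      exact c.exploreCost_le hl B p o
    have hy0 : 0 ≤ c.leaderLoss l p o / c.τ := div_nonneg (c.leaderLoss_mem_Icc hl p o).1 hτ'.le
    have hy1 : c.leaderLoss l p o / c.τ ≤ 1 :=
      div_le_one_of_le₀ (c.leaderLoss_mem_Icc hl p o).2 hτ'.le
    -- Both values of F fit one form: a discarded estimate is that of the loss y = 0.
    obtain ⟨y, h0, h1, hy⟩ : ∃ y : ℝ, 0 ≤ y ∧ y ≤ 1 ∧ (if c.leaderFlag l p o.1 then 0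
        else (c.M : ℝ) * (c.leaderLoss l p o / c.τ) / c.marginal L (o.1 c.leader))
          = (c.M : ℝ) * y / c.marginal L (o.1 c.leader) := by
      split_ifs
      · exact ⟨0, le_rfl, zero_le_one, by simp⟩
      · exact ⟨_, hy0, hy1, rfl⟩
    rw [lossEstimate_eq_single, hy]
    have hstep := c.potential_step_le hη B L (o.1 c.leader) h0 h1
    have hsum : (∑ m, if o.1 c.leader = B m then
          (c.M : ℝ) * y / c.marginal L (o.1 c.leader) else 0)
        ≤ ∑ m, if o.1 c.leader = B m then (c.M : ℝ) * 1 / c.marginal L (o.1 c.leader) else 0 := by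
      refine Finset.sum_le_sum fun m _ => ?_
      split_ifs
      · gcongr
      · exact le_rfl
    have hMy : 0 ≤ c.M * y := mul_nonneg hM.le h0
    simp only [Finset.sum_const_zero]
    linarith
  · simp only [mul_add, Finset.sum_add_distrib, mul_zero, Finset.sum_const_zero]
    rw [sum_marginal_mul_inv, ← Finset.sum_mul, ← Finset.sum_mul, sum_marginal,
      c.sum_marginal_mul_single L B fun _ => 1]
    simp only [Finset.sum_const, Finset.card_univ, Fintype.card_fin, nsmul_eq_mul]
    field_simp
    ring

/-! ### Summing the drift over the phases -/

variable (l)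

theorem expect_law_sum_le {F : ℕ → c.Outcome → ℝ} {D : (Fin c.K → ℝ) → ℝ} {b : ℕ → ℝ}
    (hD : ∀ L, 0 ≤ D L)
    (hstep : ∀ p L, expect (c.phaseLaw l p L) (fun o => F p o + D (L + c.lossEstimate l p L o))
      ≤ D L + b p) (n : ℕ) :
    expect (c.law l n) (fun h => ∑ p : Fin n, F p (h p)) ≤ D 0 + ∑ p ∈ Finset.range n, b p := by
  -- The final value of D is kept in the induction, which makes the sum telescope; it is dropped at
  -- the end by nonnegativity.
  have key : ∀ n, expect (c.law l n) (fun h => ∑ p : Fin n, F p (h p) + D (c.cumEstimate l n h))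
      ≤ D 0 + ∑ p ∈ Finset.range n, b p := by
    intro n
    induction n with
    | zero => simp [law, expect_pure, cumEstimate]
    | succ n ih =>
      rw [expect_law_succ, Finset.sum_range_succ, ← add_assoc]
      refine le_trans ?_ (add_le_add_left ih (b n))
      rw [← expect_const (c.law l n) (b n), ← expect_add]
      refine expect_mono fun h => ?_
      simp only [Fin.sum_univ_castSucc, Fin.snoc_castSucc, Fin.snoc_last, cumEstimate,
        Fin.init_snoc, Fin.val_castSucc, Fin.val_last, add_assoc]
      rw [expect_add, expect_const]
      linarith [hstep n (c.cumEstimate l n h)]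
  refine le_trans (expect_mono fun h => ?_) (key n)
  linarith [hD (c.cumEstimate l n h)]

variable {l}

theorem sum_range_ite_eq_card (n : ℕ) (x : ℝ) :
    ∑ p ∈ Finset.range n, (if ∃ m, c.Attacked l p m then x else 0)
      = x * #{p ∈ Finset.range n | ∃ m, c.Attacked l p m} := by
  rw [← Finset.sum_filter, Finset.sum_const, nsmul_eq_mul, mul_comm]

/-- The expected regret of the first `n` exploration phases. -/
theorem expect_sum_exploreCost_le (hl : ∀ t k, 0 ≤ l t k ∧ l t k ≤ 1) (hη : 0 < c.η)
    (hτ : 0 < c.τ) (B : c.Assignment) (n : ℕ) :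
    expect (c.law l n) (fun h => ∑ p : Fin n, c.exploreCost l B p (h p) / c.τ)
      ≤ Real.log (c.K.choose c.M) / c.η + n * (c.η * c.K * c.M)
        + 2 * c.M * #{p ∈ Finset.range n | ∃ m, c.Attacked l p m} := by
  refine (c.expect_law_sum_le l (F := fun p o => c.exploreCost l B p o / c.τ)
    (D := c.potential B) (b := fun p => c.η * c.K * c.M +
      if ∃ m, c.Attacked l p m then 2 * (c.M : ℝ) else 0) (c.potential_nonneg hη B)
    (fun p L => ?_) n).trans (le_of_eq ?_)
  · split_ifs with hp
    · linarith [c.expect_drift_le hl hη hτ B p L]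
    · linarith [c.expect_drift_le_of_not_attacked hl hη B hp L]
  · rw [potential_zero, Finset.sum_add_distrib, sum_range_ite_eq_card, Finset.sum_const,
      Finset.card_range, nsmul_eq_mul]
    ring

/-- With as many players as arms, exploration without communication errors has no regret. -/
theorem expect_sum_exploreCost_le_of_eq (hl : ∀ t k, 0 ≤ l t k ∧ l t k ≤ 1) (hMK : c.M = c.K)
    (hτ : 0 < c.τ) (B : c.Assignment) (n : ℕ) :
    expect (c.law l n) (fun h => ∑ p : Fin n, c.exploreCost l B p (h p) / c.τ)
      ≤ c.M * #{p ∈ Finset.range n | ∃ m, c.Attacked l p m} := by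
  have hτ' : (0 : ℝ) < c.τ := by positivity
  -- Every assignment uses all the arms, so without errors each phase costs exactly what B costs,
  -- and the zero potential suffices.
  have hperm : ∀ (a : c.Assignment) (f : Fin c.K → ℝ), ∑ m, f (a m) = ∑ k, f k := fun a f =>
    Function.Bijective.sum_comp
      ((Fintype.bijective_iff_injective_and_card a).2 ⟨a.injective, by simpa using hMK⟩) f
  refine (c.expect_law_sum_le l (F := fun p o => c.exploreCost l B p o / c.τ)
    (D := fun _ => 0) (b := fun p => if ∃ m, c.Attacked l p m then (c.M : ℝ) else 0)
    (fun _ => le_rfl) (fun p L => ?_) n).trans (le_of_eq ?_)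
  · refine le_trans (expect_mono_support (g := fun _ =>
      0 + if ∃ m, c.Attacked l p m then (c.M : ℝ) else 0) fun o ho => ?_)
      (expect_const _ _).le
    split_ifs with hp
    · have := c.exploreCost_le hl B p o
      rw [add_zero, zero_add, div_le_iff₀ hτ', mul_comm]
      exact this
    · rw [c.exploreCost_eq (c.snd_eq_of_mem_support hp ho), hperm, hperm]
      simp
  · rw [sum_range_ite_eq_card, zero_add]

end Params

/-! ### Splitting the horizon into phases -/

theorem sum_range_mul_eq (G : ℕ → ℝ) (q n : ℕ) :
    ∑ t ∈ Finset.range (n * q), G t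
      = ∑ p ∈ Finset.range n, ∑ o ∈ Finset.range q, G (p * q + o) := by
  induction n with
  | zero => simp
  | succ n ih => rw [Nat.succ_mul, Finset.sum_range_add, ih, Finset.sum_range_succ]

theorem sum_range_le_card_mul {G : ℕ → ℝ} {b : ℝ} (hG : ∀ t, G t ≤ b) (n : ℕ) :
    ∑ t ∈ Finset.range n, G t ≤ n * b :=
  (Finset.sum_le_sum fun t _ => hG t).trans (by simp)

/-- All slots except those in the second parts (of length `τ`) of the complete phases are
estimated by the bound `b`. -/
theorem sum_range_le_phases {G : ℕ → ℝ} {b : ℝ} (hb : 0 ≤ b) (hG : ∀ t, G t ≤ b) (a : ℕ) {τ : ℕ}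
    (hτ : 0 < τ) (T : ℕ) :
    ∑ t ∈ Finset.range T, G t
      ≤ (T / (a + τ) : ℕ) * (a * b)
        + ∑ p ∈ Finset.range (T / (a + τ)), ∑ i ∈ Finset.range τ, G (p * (a + τ) + (a + i))
        + (min (T : ℝ) a + τ) * b := by
  have hT : T / (a + τ) * (a + τ) + T % (a + τ) = T := Nat.div_add_mod' T (a + τ)
  have hsplit : ∑ t ∈ Finset.range T, G t
      = ∑ p ∈ Finset.range (T / (a + τ)), (∑ o ∈ Finset.range a, G (p * (a + τ) + o)
          + ∑ i ∈ Finset.range τ, G (p * (a + τ) + (a + i)))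
        + ∑ o ∈ Finset.range (T % (a + τ)), G (T / (a + τ) * (a + τ) + o) := by
    conv_lhs => rw [← hT, Finset.sum_range_add, sum_range_mul_eq]
    simp only [Finset.sum_range_add]
  have h1 : ∑ p ∈ Finset.range (T / (a + τ)), ∑ o ∈ Finset.range a, G (p * (a + τ) + o)
      ≤ (T / (a + τ) : ℕ) * (a * b) :=
    sum_range_le_card_mul (fun p => sum_range_le_card_mul (fun o => hG _) a) _
  have h2 : ∑ o ∈ Finset.range (T % (a + τ)), G (T / (a + τ) * (a + τ) + o)
      ≤ (min (T : ℝ) a + τ) * b := by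
    refine (sum_range_le_card_mul (fun o => hG _) _).trans (mul_le_mul_of_nonneg_right ?_ hb)
    -- The incomplete phase is shorter than a full phase and no longer than T. The truncation at T
    -- is needed when a communication phase exceeds the horizon.
    have h3 : T % (a + τ) ≤ min T a + τ := by
      have h4 := Nat.mod_lt T (show 0 < a + τ by omega)
      have h5 := Nat.mod_le T (a + τ)
      omega
    exact_mod_cast h3
  rw [hsplit, Finset.sum_add_distrib]
  linarith

namespace Params

variable (c : Params) {l : ℕ → Fin c.K → ℝ}

/-! ### The regret -/

/-- The minimizing allocation does not depend on the pulls, so one B serves all realizations and can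
be fixed before taking expectations. -/
theorem exists_regret_eq (l : ℕ → Fin c.K → ℝ) (T : ℕ) : ∃ B : c.Assignment,
    ∀ π : Fin T → Fin c.M → Fin c.K,
      regret l T π = ∑ t : Fin T, (∑ m, received (l t) (π t) m - ∑ m, l t (B m)) := by
  have : Nonempty (Fin c.M ↪ Fin c.K) := ⟨Fin.castLEEmb c.M_le_K⟩
  obtain ⟨B, hB⟩ := exists_eq_ciInf_of_finite
    (f := fun a : Fin c.M ↪ Fin c.K => ∑ t : Fin T, ∑ m, l t (a m))
  exact ⟨B, fun π => by rw [regret, ← hB, Finset.sum_sub_distrib]⟩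

theorem sum_pulls_le (hl : ∀ t k, 0 ≤ l t k ∧ l t k ≤ 1) (hτ : 0 < c.τ) (B : c.Assignment)
    (T : ℕ) (h : Fin (T / c.phaseLen + 1) → c.Outcome) :
    ∑ t : Fin T, (∑ m, received (l t) (c.pulls l T h t) m - ∑ m, l t (B m))
      ≤ (T / c.phaseLen : ℕ) * (c.commLen * c.M)
        + ∑ p : Fin (T / c.phaseLen), c.exploreCost l B p (h p.castSucc)
        + (min (T : ℝ) c.commLen + c.τ) * c.M := by
  have hpos : 0 < c.phaseLen := Nat.add_pos_right _ hτ
  -- The default `h 0` is never reached: slots before T lie in phases with index at most `T /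
  -- phaseLen`.
  set h' : ℕ → c.Outcome := fun p =>
    if hp : p < T / c.phaseLen + 1 then h ⟨p, hp⟩ else h 0 with hh'
  set G : ℕ → ℝ := fun t =>
    ∑ m, received (l t) (c.phasePull l (t / c.phaseLen) (h' (t / c.phaseLen)) (t % c.phaseLen)) m
      - ∑ m, l t (B m) with hG
  have hsum : ∑ t : Fin T, (∑ m, received (l t) (c.pulls l T h t) m - ∑ m, l t (B m))
      = ∑ t ∈ Finset.range T, G t := by
    rw [← Fin.sum_univ_eq_sum_range]
    refine Finset.sum_congr rfl fun t _ => ?_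
    have ht : (t : ℕ) / c.phaseLen < T / c.phaseLen + 1 :=
      Nat.lt_succ_of_le (Nat.div_le_div_right t.2.le)
    simp only [hG, hh', dif_pos ht]
    rfl
  rw [hsum]
  refine (sum_range_le_phases (Nat.cast_nonneg c.M) (fun t => c.sum_received_sub_le hl B t _)
    c.commLen hτ T).trans (le_of_eq ?_)
  congr 2
  rw [← Fin.sum_univ_eq_sum_range
    (fun p => ∑ i ∈ Finset.range c.τ, G (p * (c.commLen + c.τ) + (c.commLen + i)))]
  refine Finset.sum_congr rfl fun p _ => ?_
  rw [← Fin.sum_univ_eq_sum_range (fun i => G (p * (c.commLen + c.τ) + (c.commLen + i)))]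
  refine Finset.sum_congr rfl fun i _ => ?_
  have hi : c.commLen + (i : ℕ) < c.phaseLen := Nat.add_lt_add_left i.2 _
  have hdiv : ((p : ℕ) * c.phaseLen + (c.commLen + i)) / c.phaseLen = p := by
    rw [mul_comm, Nat.mul_add_div hpos, Nat.div_eq_of_lt hi, add_zero]
  have hmod : ((p : ℕ) * c.phaseLen + (c.commLen + i)) % c.phaseLen = c.commLen + i := by
    rw [mul_comm, Nat.mul_add_mod, Nat.mod_eq_of_lt hi]
  have hp : (p : ℕ) < T / c.phaseLen + 1 := Nat.lt_succ_of_lt p.2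
  have hn1 : ¬ c.commLen + (i : ℕ) < c.assignLen := by unfold commLen; omega
  have hn2 : ¬ c.commLen + (i : ℕ) < c.commLen := by omega
  change G (p * c.phaseLen + (c.commLen + i)) = _
  simp only [hG, hdiv, hmod, phasePull, if_neg hn1, if_neg hn2, hh', dif_pos hp]
  rfl

theorem expectedRegret_le (hl : ∀ t k, 0 ≤ l t k ∧ l t k ≤ 1) (hτ : 0 < c.τ) (T : ℕ) {x : ℝ}
    (hx : ∀ B : c.Assignment, expect (c.law l (T / c.phaseLen))
      (fun h => ∑ p : Fin (T / c.phaseLen), c.exploreCost l B p (h p) / c.τ) ≤ x) :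
    c.expectedRegret l T
      ≤ (T / c.phaseLen : ℕ) * (c.commLen * c.M) + c.τ * x
        + (min (T : ℝ) c.commLen + c.τ) * c.M := by
  obtain ⟨B, hB⟩ := c.exists_regret_eq l T
  have hτ' : (c.τ : ℝ) ≠ 0 := by positivity
  have h1 : c.expectedRegret l T = expect (c.law l (T / c.phaseLen + 1))
      (fun h => regret l T (c.pulls l T h)) := rfl
  -- The integrand ignores the last, incomplete phase, whose choices integrate out.
  have h2 : expect (c.law l (T / c.phaseLen + 1))
      (fun h => ∑ p : Fin (T / c.phaseLen), c.exploreCost l B p (h p.castSucc))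
      = c.τ * expect (c.law l (T / c.phaseLen))
        (fun h => ∑ p : Fin (T / c.phaseLen), c.exploreCost l B p (h p) / c.τ) := by
    rw [expect_law_succ, ← expect_const_mul]
    simp only [Fin.snoc_castSucc, expect_const, ← Finset.sum_div, mul_div_cancel₀ _ hτ']
  rw [h1]
  simp only [hB]
  refine (expect_mono fun h => c.sum_pulls_le hl hτ B T h).trans ?_
  rw [expect_add, expect_add, expect_const, expect_const, h2]
  gcongr
  exact hx B

theorem rep_mul_card_attacked_div_le (T : ℕ) :
    c.rep * #{p ∈ Finset.range (T / c.phaseLen) | ∃ m, c.Attacked l p m}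
      ≤ c.M * globalAttackability l T := by
  refine le_trans (Nat.mul_le_mul_left _ (Finset.card_le_card fun p hp => ?_))
    (c.rep_mul_card_exists_attacked_le (l := l) T (T / c.phaseLen))
  rw [Finset.mem_filter, Finset.mem_range] at hp ⊢
  refine ⟨hp.1, ?_, hp.2⟩
  have h1 : (p + 1) * c.phaseLen ≤ T :=
    (Nat.mul_le_mul_right _ hp.1).trans (Nat.div_mul_le_self T c.phaseLen)
  rw [Nat.succ_mul] at h1
  have : c.commLen ≤ c.phaseLen := Nat.le_add_right _ _
  omega

theorem commLen_le : c.commLen ≤ c.M * c.K * c.rep := by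
  have hM := c.one_lt_M
  obtain ⟨m, hm⟩ : ∃ m, c.M = m + 1 := ⟨c.M - 1, by omega⟩
  have hK := c.K_pos
  unfold commLen assignLen
  rw [hm, Nat.add_sub_cancel, ← Nat.succ_mul]
  refine Nat.mul_le_mul_right _ ?_
  rw [Nat.succ_mul]
  omega

end Params

/-! ### The learning rate and the explicit regret bound -/

/-- The choice of the learning rate balances the two terms of the exponential weights bound. -/
theorem balance_eq {N τ D : ℝ} (hN : 0 < N) (hτ : 0 < τ) (hD : 0 < D) :
    τ * (N / √(N * τ / D)) + √(N * τ / D) * D = 2 * √(N * τ * D) := by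
  have hη : 0 < √(N * τ / D) := Real.sqrt_pos.2 (by positivity)
  have hsq : √(N * τ / D) ^ 2 = N * τ / D := Real.sq_sqrt (by positivity)
  have h1 : √(N * τ * D) = √(N * τ / D) * D := by
    rw [show N * τ * D = N * τ / D * D ^ 2 by field_simp, Real.sqrt_mul (by positivity),
      Real.sqrt_sq hD.le]
  have h2 : τ * (N / √(N * τ / D)) = √(N * τ / D) * D := by
    rw [mul_div_assoc', div_eq_iff hη.ne']
    have : N * τ = √(N * τ / D) ^ 2 * D := by rw [hsq]; field_simp
    linarith [this]
  rw [h1, h2]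
  ring

theorem log_choose_le {M K : ℕ} (hMK : M ≤ K) :
    Real.log (K.choose M) ≤ M * Real.log K := by
  rw [← Real.log_pow]
  refine Real.log_le_log (by exact_mod_cast Nat.choose_pos hMK) ?_
  exact_mod_cast Nat.choose_le_pow K M

theorem betaAware_expectedRegret_le {M K : ℕ} (hM : 1 < M) (hMK : M ≤ K) (β : ℝ) {T rep : ℕ}
    (hT : 1 ≤ T) (hτ : 0 < exploreLen K T β) {l : ℕ → Fin K → ℝ}
    (hl : ∀ t k, 0 ≤ l t k ∧ l t k ≤ 1) :
    ∃ S : ℕ, rep * S ≤ M * globalAttackability l T ∧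
      (betaAware M K hM hMK β T rep).expectedRegret l T
        ≤ T / exploreLen K T β * (M ^ 2 * K * rep)
          + 2 * (M * √(Real.log K * exploreLen K T β * (K * T)))
          + 2 * M * exploreLen K T β * S
          + (min (T : ℝ) (M * K * rep) + exploreLen K T β) * M := by
  set τ := exploreLen K T β with hτdef
  set c := betaAware M K hM hMK β T rep with hc
  have hcM : c.M = M := rfl
  have hcK : c.K = K := rfl
  have hcτ : c.τ = τ := rfl
  have hcη : c.η = √(Real.log (K.choose M) * τ / (M * K * T)) := rfl
  set n := T / c.phaseLen with hn
  set S := #{p ∈ Finset.range n | ∃ m, c.Attacked l p m} with hS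
  have hτ' : (0 : ℝ) < τ := by exact_mod_cast hτ
  have hM' : (0 : ℝ) < M := by positivity
  have hK' : (0 : ℝ) < K := by have : 0 < K := by omega
                               positivity
  have hT' : (0 : ℝ) < T := by positivity
  have hlogK : 0 ≤ Real.log K := Real.log_natCast_nonneg K
  have hnτ : (n : ℝ) * τ ≤ T := by
    have h : n * τ ≤ T := (Nat.mul_le_mul_left n (Nat.le_add_left _ _)).trans
      (Nat.div_mul_le_self T c.phaseLen)
    exact_mod_cast h
  have hcomm : (c.commLen : ℝ) ≤ M * K * rep := by exact_mod_cast c.commLen_le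
  refine ⟨S, c.rep_mul_card_attacked_div_le T, ?_⟩
  obtain ⟨x, hx, hxle⟩ : ∃ x : ℝ, (∀ B : c.Assignment, expect (c.law l n)
      (fun h => ∑ p : Fin n, c.exploreCost l B p (h p) / c.τ) ≤ x) ∧
      τ * x ≤ 2 * (M * √(Real.log K * τ * (K * T))) + 2 * M * τ * S := by
    -- For M = K the binomial coefficient is 1, so η = 0 and the potential is unavailable.
    rcases hMK.eq_or_lt with heq | hlt
    · refine ⟨M * S, fun B => c.expect_sum_exploreCost_le_of_eq hl heq hτ B n, ?_⟩
      have h1 : 0 ≤ 2 * (M * √(Real.log K * τ * (K * T))) := by positivity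
      have h2 : (0 : ℝ) ≤ M * τ * S := by positivity
      linarith
    · have hN : 0 < Real.log (K.choose M) := by
        refine Real.log_pos ?_
        have h1 : K.choose M ≠ 1 := fun h => by
          rcases Nat.choose_eq_one_iff.1 h with h | h <;> omega
        have h2 : 1 < K.choose M := by have := Nat.choose_pos hMK; omega
        exact_mod_cast h2
      have hη : 0 < c.η := by
        rw [hcη]
        exact Real.sqrt_pos.2 (by positivity)
      refine ⟨Real.log (K.choose M) / c.η + n * (c.η * K * M) + 2 * M * S,
        fun B => c.expect_sum_exploreCost_le hl hη hτ B n, ?_⟩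
      have hbal := balance_eq hN hτ' (show (0 : ℝ) < M * K * T by positivity)
      rw [← hcη] at hbal
      -- At most T/τ complete phases fit, which turns the quadratic terms into ηMKT, the second term
      -- of `balance_eq` with D = MKT.
      have h1 : (n : ℝ) * τ * (c.η * (M * K)) ≤ T * (c.η * (M * K)) :=
        mul_le_mul_of_nonneg_right hnτ (by positivity)
      have h2 : √(Real.log (K.choose M) * τ * (M * K * T))
          ≤ M * √(Real.log K * τ * (K * T)) := by
        rw [← Real.sqrt_sq hM'.le, ← Real.sqrt_mul (by positivity), Real.sqrt_sq hM'.le]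
        refine Real.sqrt_le_sqrt ?_
        have := mul_le_mul_of_nonneg_right (log_choose_le hMK)
          (show (0 : ℝ) ≤ τ * (M * K * T) by positivity)
        linarith
      linarith
  refine (c.expectedRegret_le hl hτ T hx).trans ?_
  rw [hcM, hcτ, ← hn]
  have h1 : (n : ℝ) * (c.commLen * M) ≤ T / τ * (M ^ 2 * K * rep) := by
    have h2 : (n : ℝ) ≤ T / τ := (le_div_iff₀ hτ').2 hnτ
    have h3 : (c.commLen : ℝ) * M ≤ M ^ 2 * K * rep := by
      have := mul_le_mul_of_nonneg_right hcomm hM'.le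
      linarith
    exact mul_le_mul h2 h3 (by positivity) (by positivity)
  have h4 : (min (T : ℝ) c.commLen + τ) * M ≤ (min (T : ℝ) (M * K * rep) + τ) * M := by
    gcongr
  linarith

/-! ### The final estimates

In the following lemmas `a = K ^ (1/3)`, `g = log K ^ (1/3)`, `u = T ^ max β (1/3)`,
`w = T ^ ν` and `U = T ^ max ((1 + β)/2) (2/3)`. -/

theorem rpow_one_third_pow {x : ℝ} (hx : 0 ≤ x) : (x ^ (1 / 3 : ℝ)) ^ 3 = x := by
  rw [← Real.rpow_natCast, ← Real.rpow_mul hx]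
  norm_num

theorem log_rpow_one_third_bounds {K : ℕ} (hK : 2 ≤ K) :
    3 / 4 ≤ Real.log K ^ (1 / 3 : ℝ) ∧ Real.log K ^ (1 / 3 : ℝ) ≤ (K : ℝ) ^ (1 / 3 : ℝ) := by
  have hK' : (2 : ℝ) ≤ K := by exact_mod_cast hK
  have hlog : 1 / 2 ≤ Real.log K := by
    have := Real.log_le_log (by norm_num) hK'
    linarith [Real.log_two_gt_d9]
  refine ⟨?_, Real.rpow_le_rpow (by linarith) (Real.log_le_self (by linarith)) (by norm_num)⟩
  refine le_of_pow_le_pow_left₀ (n := 3) (by norm_num) (Real.rpow_nonneg (by linarith) _) ?_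
  rw [rpow_one_third_pow (by linarith)]
  linarith

theorem exploreLen_bounds {K T : ℕ} (hK : 2 ≤ K) (hT : 1 ≤ T) {β : ℝ} (hβ : 0 ≤ β) :
    (K : ℝ) ^ (1 / 3 : ℝ) / Real.log K ^ (1 / 3 : ℝ) * (T : ℝ) ^ max β (1 / 3)
        ≤ exploreLen K T β ∧
      (exploreLen K T β : ℝ)
        ≤ 2 * ((K : ℝ) ^ (1 / 3 : ℝ) / Real.log K ^ (1 / 3 : ℝ) * (T : ℝ) ^ max β (1 / 3)) := by
  obtain ⟨hg, hga⟩ := log_rpow_one_third_bounds hK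
  have hlog : 0 ≤ Real.log K := Real.log_natCast_nonneg K
  have hT' : (1 : ℝ) ≤ T := by exact_mod_cast hT
  have heq : exploreLen K T β
      = ⌈(K : ℝ) ^ (1 / 3 : ℝ) / Real.log K ^ (1 / 3 : ℝ) * (T : ℝ) ^ max β (1 / 3)⌉₊ := by
    rw [exploreLen, Real.rpow_neg hlog, ← div_eq_mul_inv]
  have h1 : 1 ≤ (K : ℝ) ^ (1 / 3 : ℝ) / Real.log K ^ (1 / 3 : ℝ) := by
    rwa [one_le_div (by linarith)]
  have h2 : 1 ≤ (T : ℝ) ^ max β (1 / 3) := Real.one_le_rpow hT' (le_max_of_le_left hβ)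
  have h3 := one_le_mul_of_one_le_of_one_le h1 h2
  rw [heq]
  refine ⟨Nat.le_ceil _, ?_⟩
  linarith [Nat.ceil_lt_add_one (zero_le_one.trans h3)]

theorem exponent_relations {β : ℝ} (hβ1 : β ≤ 1) :
    max ((1 + β) / 2) (2 / 3) = 1 + nu β - max β (1 / 3) ∧
      max ((1 + β) / 2) (2 / 3) * 2 = 1 + max β (1 / 3) ∧
      max β (1 / 3) + (β - nu β) ≤ max ((1 + β) / 2) (2 / 3) ∧
      max β (1 / 3) ≤ max ((1 + β) / 2) (2 / 3) ∧
      1 + nu β * 2 ≤ max ((1 + β) / 2) (2 / 3) * 3 := by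
  unfold nu
  rcases le_total β (1 / 3) with h | h
  · rw [max_eq_right h, max_eq_right (by linarith), max_eq_right (by linarith)]
    refine ⟨?_, ?_, ?_, ?_, ?_⟩ <;> linarith
  · rw [max_eq_left h, max_eq_left (by linarith), max_eq_left (by linarith)]
    refine ⟨?_, ?_, ?_, ?_, ?_⟩ <;> linarith

/-- The summands of the constant belong, in order, to communication (`h1`), exploration (`h2`),
failures (`h3`), and the communication (`h5`) and exploration (`h4`) parts of the last phase. -/
theorem regret_terms_le {M a g u w U T Tβ τ rep S v c₁ c₂ : ℝ} (hM : 1 ≤ M) (hg : 3 / 4 ≤ g)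
    (ha1 : 1 ≤ a) (hu : 0 < u) (hw : 0 < w) (hU : 0 < U) (hT : 0 < T)
    (hv : 0 < v) (hc₁ : 0 < c₁) (hc₂ : 0 < c₂)
    (hτ1 : a / g * u ≤ τ) (hτ2 : τ ≤ 2 * (a / g * u)) (hrep : rep ≤ c₂ * w)
    (hrep0 : 0 ≤ rep) (hS : S ≤ v / c₁ * (M * Tβ))
    (h1 : U * u = T * w) (h2 : U ^ 2 = T * u) (h3 : u * Tβ ≤ U) (h4 : u ≤ U)
    (h5 : T * w ^ 2 ≤ U ^ 3) :
    T / τ * (M ^ 2 * a ^ 3 * rep) + 2 * (M * √(g ^ 3 * τ * (a ^ 3 * T))) + 2 * M * τ * S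
        + (min T (M * a ^ 3 * rep) + τ) * M
      ≤ (c₂ + 4 + 8 * (v / c₁) + 2 * (1 + c₂) + 4) * (M ^ 2 * a ^ 2 * g * U) := by
  have hg0 : 0 < g := by linarith
  have ha0 : 0 < a := by linarith
  have hM0 : 0 < M := by linarith
  have hx : 0 < a / g * u := by positivity
  have hτ : 0 < τ := hx.trans_le hτ1
  -- Uses 2g² ≥ 1, the reason for the lower bound 3/4 on g.
  have hag : a / g ≤ 2 * (a ^ 2 * g) := by
    rw [div_le_iff₀ hg0]
    have h6 : 1 ≤ 2 * g ^ 2 := by nlinarith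
    have h7 : a * 1 ≤ a * (a * (2 * g ^ 2)) :=
      mul_le_mul_of_nonneg_left (one_le_mul_of_one_le_of_one_le ha1 h6) ha0.le
    linarith
  have hMM : M ≤ M ^ 2 := by nlinarith
  have hP : 0 < a ^ 2 * g * U := by positivity
  have hMP : M * (a ^ 2 * g * U) ≤ M ^ 2 * (a ^ 2 * g * U) :=
    mul_le_mul_of_nonneg_right hMM hP.le
  have hcomm : T / τ * (M ^ 2 * a ^ 3 * rep) ≤ c₂ * (M ^ 2 * a ^ 2 * g * U) := by
    calc T / τ * (M ^ 2 * a ^ 3 * rep)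
        ≤ T / (a / g * u) * (M ^ 2 * a ^ 3 * (c₂ * w)) := by gcongr
      _ = c₂ * (M ^ 2 * a ^ 2 * g * (T * w / u)) := by field_simp
      _ = c₂ * (M ^ 2 * a ^ 2 * g * U) := by rw [← h1]; field_simp
  have hexp : 2 * (M * √(g ^ 3 * τ * (a ^ 3 * T))) ≤ 4 * (M ^ 2 * a ^ 2 * g * U) := by
    have h6 : √(g ^ 3 * τ * (a ^ 3 * T)) ≤ 2 * (a ^ 2 * g * U) := by
      refine Real.sqrt_le_iff.2 ⟨by positivity, ?_⟩
      calc g ^ 3 * τ * (a ^ 3 * T) ≤ g ^ 3 * (2 * (a / g * u)) * (a ^ 3 * T) := by gcongr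
        _ = 2 * (a ^ 4 * g ^ 2 * (T * u)) := by field_simp
        _ = 2 * (a ^ 4 * g ^ 2 * U ^ 2) := by rw [h2]
        _ ≤ 4 * (a ^ 4 * g ^ 2 * U ^ 2) := by
            have : 0 ≤ a ^ 4 * g ^ 2 * U ^ 2 := by positivity
            linarith
        _ = (2 * (a ^ 2 * g * U)) ^ 2 := by ring
    have := mul_le_mul_of_nonneg_left h6 hM0.le
    linarith
  have hfail : 2 * M * τ * S ≤ 8 * (v / c₁) * (M ^ 2 * a ^ 2 * g * U) := by
    calc 2 * M * τ * S ≤ 2 * M * τ * (v / c₁ * (M * Tβ)) := by gcongr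
      _ ≤ 2 * M * τ * (v / c₁ * (M * (U / u))) := by
          have : Tβ ≤ U / u := by rwa [le_div_iff₀ hu, mul_comm]
          gcongr
      _ ≤ 2 * M * (2 * (a / g * u)) * (v / c₁ * (M * (U / u))) := by gcongr
      _ = 4 * (v / c₁) * M ^ 2 * U * (a / g) := by field_simp; ring
      _ ≤ 4 * (v / c₁) * M ^ 2 * U * (2 * (a ^ 2 * g)) := by gcongr
      _ = _ := by ring
  have hmin : min T (M * a ^ 3 * rep) ≤ 2 * (1 + c₂) * (M * (a ^ 2 * g * U)) := by
    have hX : M * a ^ 2 * U ≤ 2 * (M * (a ^ 2 * g * U)) := by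
      have : 0 < M * a ^ 2 * U := by positivity
      nlinarith
    have hX0 : 0 < M * a ^ 2 * U := by positivity
    rcases le_total (a * w) U with h6 | h6
    · refine (min_le_right _ _).trans ?_
      calc M * a ^ 3 * rep ≤ M * a ^ 3 * (c₂ * w) := by gcongr
        _ = c₂ * (M * a ^ 2 * (a * w)) := by ring
        _ ≤ c₂ * (M * a ^ 2 * U) := by gcongr
        _ ≤ (1 + c₂) * (M * a ^ 2 * U) := by linarith
        _ ≤ (1 + c₂) * (2 * (M * (a ^ 2 * g * U))) := by gcongr
        _ = _ := by ring
    · refine (min_le_left _ _).trans ?_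
      have h7 : T * w ^ 2 ≤ a ^ 2 * U * w ^ 2 := by
        calc T * w ^ 2 ≤ U ^ 2 * U := by linarith
          _ ≤ (a * w) ^ 2 * U := by gcongr
          _ = _ := by ring
      have h8 : T ≤ a ^ 2 * U := le_of_mul_le_mul_right h7 (by positivity)
      calc T ≤ 1 * (a ^ 2 * U) := by linarith
        _ ≤ M * (a ^ 2 * U) := by gcongr
        _ = 1 * (M * a ^ 2 * U) := by ring
        _ ≤ (1 + c₂) * (M * a ^ 2 * U) := by gcongr; linarith
        _ ≤ (1 + c₂) * (2 * (M * (a ^ 2 * g * U))) := by gcongr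
        _ = _ := by ring
  have hlast : τ * M ≤ 4 * (M ^ 2 * a ^ 2 * g * U) := by
    calc τ * M ≤ 2 * (2 * (a ^ 2 * g) * U) * M := by
          gcongr
          exact hτ2.trans (by gcongr)
      _ = 4 * (M * (a ^ 2 * g * U)) := by ring
      _ ≤ _ := by linarith
  have hmin' : min T (M * a ^ 3 * rep) * M ≤ 2 * (1 + c₂) * (M ^ 2 * a ^ 2 * g * U) := by
    have := mul_le_mul_of_nonneg_right hmin hM0.le
    linarith
  linarith

theorem betaAware_bounds {v c₁ c₂ : ℝ} (hv : 0 < v) (hc₁ : 0 < c₁) (hc₂ : 0 < c₂) {M K : ℕ}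
    (hM : 1 < M) (hMK : M ≤ K) {β : ℝ} (hβ : 0 ≤ β) (hβ1 : β ≤ 1) {T rep : ℕ} (hT : 1 ≤ T)
    (hrep1 : c₁ * (T : ℝ) ^ nu β ≤ rep) (hrep2 : (rep : ℝ) ≤ c₂ * (T : ℝ) ^ nu β)
    {l : ℕ → Fin K → ℝ} (hl : ∀ t k, 0 ≤ l t k ∧ l t k ≤ 1)
    (hV : (globalAttackability l T : ℝ) ≤ v * (T : ℝ) ^ β) :
    (betaAware M K hM hMK β T rep).expectedRegret l T
        ≤ (c₂ + 4 + 8 * (v / c₁) + 2 * (1 + c₂) + 4)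
          * ((M : ℝ) ^ 2 * (K : ℝ) ^ (2 / 3 : ℝ) * Real.log K ^ (1 / 3 : ℝ)
            * (T : ℝ) ^ max ((1 + β) / 2) (2 / 3)) ∧
      ∀ h, ((betaAware M K hM hMK β T rep).numFailed l T h : ℝ)
        ≤ v / c₁ * (M * (T : ℝ) ^ (β - nu β)) := by
  have hT' : (0 : ℝ) < T := by positivity
  have hT1 : (1 : ℝ) ≤ T := by exact_mod_cast hT
  have hK2 : 2 ≤ K := le_trans hM hMK
  have hK1 : (1 : ℝ) ≤ K := by exact_mod_cast (show 1 ≤ K by omega)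
  have hM1 : (1 : ℝ) ≤ M := by exact_mod_cast hM.le
  have hw : 0 < (T : ℝ) ^ nu β := Real.rpow_pos_of_pos hT' _
  have hcount : ∀ S : ℕ, rep * S ≤ M * globalAttackability l T →
      (S : ℝ) ≤ v / c₁ * (M * (T : ℝ) ^ (β - nu β)) := by
    intro S hS
    have hS' : (rep : ℝ) * S ≤ M * globalAttackability l T := by exact_mod_cast hS
    have h1 : c₁ * (T : ℝ) ^ nu β * S ≤ M * (v * (T : ℝ) ^ β) :=
      (mul_le_mul_of_nonneg_right hrep1 (Nat.cast_nonneg S)).trans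
        (hS'.trans (mul_le_mul_of_nonneg_left hV (by positivity)))
    rw [Real.rpow_sub hT']
    calc (S : ℝ) ≤ M * (v * (T : ℝ) ^ β) / (c₁ * (T : ℝ) ^ nu β) := by
          rw [le_div_iff₀ (by positivity)]
          linarith
      _ = _ := by field_simp
  refine ⟨?_, fun h => hcount _ (Params.rep_mul_numFailed_le _ T h)⟩
  obtain ⟨hg, hga⟩ := log_rpow_one_third_bounds hK2
  obtain ⟨hτ1, hτ2⟩ := exploreLen_bounds hK2 hT hβ
  have ha1 : 1 ≤ (K : ℝ) ^ (1 / 3 : ℝ) := Real.one_le_rpow hK1 (by norm_num)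
  have hu : 0 < (T : ℝ) ^ max β (1 / 3) := Real.rpow_pos_of_pos hT' _
  have hU : 0 < (T : ℝ) ^ max ((1 + β) / 2) (2 / 3) := Real.rpow_pos_of_pos hT' _
  have hτ : 0 < exploreLen K T β := by
    have : (0 : ℝ) < exploreLen K T β := lt_of_lt_of_le (by positivity) hτ1
    exact_mod_cast this
  obtain ⟨S, hS, hR⟩ := betaAware_expectedRegret_le (rep := rep) hM hMK β hT hτ hl
  obtain ⟨e1, e2, e3, e4, e5⟩ := exponent_relations hβ1
  have hlog : 0 ≤ Real.log K := Real.log_natCast_nonneg K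
  have ha3 := rpow_one_third_pow (zero_le_one.trans hK1)
  have hg3 := rpow_one_third_pow hlog
  have ha2 : (K : ℝ) ^ (2 / 3 : ℝ) = ((K : ℝ) ^ (1 / 3 : ℝ)) ^ 2 := by
    rw [← Real.rpow_natCast, ← Real.rpow_mul (zero_le_one.trans hK1)]
    norm_num
  have hfin := regret_terms_le (T := T) hM1 hg ha1 hu hw hU hT' hv hc₁ hc₂ hτ1 hτ2 hrep2
    (Nat.cast_nonneg rep) (hcount S hS)
    (by rw [e1, Real.rpow_sub hT', Real.rpow_add hT', Real.rpow_one]; field_simp)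
    (by rw [← Real.rpow_natCast, ← Real.rpow_mul hT'.le, Nat.cast_ofNat, e2, Real.rpow_add hT',
          Real.rpow_one])
    (by rw [← Real.rpow_add hT']; exact Real.rpow_le_rpow_of_exponent_le hT1 e3)
    (Real.rpow_le_rpow_of_exponent_le hT1 e4)
    (by rw [← Real.rpow_natCast, ← Real.rpow_natCast, ← Real.rpow_mul hT'.le,
          ← Real.rpow_mul hT'.le, Nat.cast_ofNat, Nat.cast_ofNat]
        calc (T : ℝ) * (T : ℝ) ^ (nu β * 2) = (T : ℝ) ^ (1 + nu β * 2) := by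
              rw [Real.rpow_add hT', Real.rpow_one]
          _ ≤ _ := Real.rpow_le_rpow_of_exponent_le hT1 e5)
  rw [ha3, hg3] at hfin
  rw [ha2]
  exact hR.trans hfin

end

end A2C2

/-! ### The theorem with its constants -/

theorem theorem2 :
    -- the regret, and the number of failed communications, with a code of length `Θ(T ^ ν)`
    (∀ v c₁ c₂ : ℝ, 0 < v → 0 < c₁ → 0 < c₂ → ∃ C : ℝ, 0 < C ∧
      ∀ (M K : ℕ) (hM : 1 < M) (hMK : M ≤ K) (β : ℝ), 0 ≤ β → β ≤ 1 →
      ∀ (T rep : ℕ), 1 ≤ T →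
        c₁ * (T : ℝ) ^ A2C2.nu β ≤ rep → (rep : ℝ) ≤ c₂ * (T : ℝ) ^ A2C2.nu β →
      ∀ l : ℕ → Fin K → ℝ, (∀ t k, 0 ≤ l t k ∧ l t k ≤ 1) →
        (A2C2.globalAttackability l T : ℝ) ≤ v * (T : ℝ) ^ β →
        (A2C2.betaAware M K hM hMK β T rep).expectedRegret l T
            ≤ C * ((M : ℝ) ^ 2 * (K : ℝ) ^ (2 / 3 : ℝ) * Real.log K ^ (1 / 3 : ℝ)
                * (T : ℝ) ^ max ((1 + β) / 2) (2 / 3)) ∧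
        ∀ h, ((A2C2.betaAware M K hM hMK β T rep).numFailed l T h : ℝ)
            ≤ C * (M * (T : ℝ) ^ (β - A2C2.nu β))) ∧
    -- no coding is needed for `β ≤ 1 / 3`: every bit is sent once
    (∀ v : ℝ, 0 < v → ∃ C : ℝ, 0 < C ∧
      ∀ (M K : ℕ) (hM : 1 < M) (hMK : M ≤ K) (β : ℝ), 0 ≤ β → β ≤ 1 / 3 →
      ∀ T : ℕ, 1 ≤ T →
      ∀ l : ℕ → Fin K → ℝ, (∀ t k, 0 ≤ l t k ∧ l t k ≤ 1) →
        (A2C2.globalAttackability l T : ℝ) ≤ v * (T : ℝ) ^ β →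
        (A2C2.betaAware M K hM hMK β T 1).expectedRegret l T
          ≤ C * ((M : ℝ) ^ 2 * (K : ℝ) ^ (2 / 3 : ℝ) * Real.log K ^ (1 / 3 : ℝ)
              * (T : ℝ) ^ (2 / 3 : ℝ))) := by
  refine ⟨fun v c₁ c₂ hv hc₁ hc₂ => ?_, fun v hv => ?_⟩
  -- The sum of the two constants serves both the regret and the failure count.
  · refine ⟨(c₂ + 4 + 8 * (v / c₁) + 2 * (1 + c₂) + 4) + v / c₁, by positivity, ?_⟩
    intro M K hM hMK β hβ hβ1 T rep hT hrep1 hrep2 l hl hV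
    have hvc : 0 ≤ v / c₁ := by positivity
    have hC : 0 ≤ c₂ + 4 + 8 * (v / c₁) + 2 * (1 + c₂) + 4 := by positivity
    have hlog : 0 ≤ Real.log K := Real.log_natCast_nonneg K
    obtain ⟨hR, hF⟩ := A2C2.betaAware_bounds hv hc₁ hc₂ hM hMK hβ hβ1 hT hrep1 hrep2 hl hV
    exact ⟨hR.trans (mul_le_mul_of_nonneg_right (by linarith) (by positivity)),
      fun h => (hF h).trans (mul_le_mul_of_nonneg_right (by linarith) (by positivity))⟩
  -- The regret constant at c₁ = c₂ = 1: for β ≤ 1/3 the exponent ν is 0, so r = 1 equals T^ν.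
  · refine ⟨1 + 4 + 8 * (v / 1) + 2 * (1 + 1) + 4, by positivity, ?_⟩
    intro M K hM hMK β hβ hβ1 T hT l hl hV
    have hnu : A2C2.nu β = 0 := max_eq_right (by linarith)
    have hmax : max ((1 + β) / 2) (2 / 3) = (2 / 3 : ℝ) := max_eq_right (by linarith)
    have h := (A2C2.betaAware_bounds (rep := 1) hv one_pos one_pos hM hMK hβ (by linarith) hT
      (by simp [hnu]) (by simp [hnu]) hl hV).1
    rwa [hmax] at h
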